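/- Let $p,q,r>0$ with $p+q+r=1$, and let $p',r',q'',r''>0$ with $p'+r'=q''+r''=1$ and $$\frac pr=\frac{p'}{r'},\qquad \frac qr=\frac{q''}{r''}.$$ Consider the Markov chain on $\{(i,j): i,j\ge 0\}$ with the following transitions. From $(i,j)$ with $i,j>0$ it moves to $(i-1,j)$, $(i,j-1)$, $(i+1,j+1)$ with probabilities $p,q,r$. From $(i,0)$ with $i>0$ it moves to $(i-1,0)$, $(i+1,1)$ with probabilities $p',r'$. From $(0,j)$ with $j>0$ it moves to $(0,j-1)$, $(1,j+1)$ with probabilities $q'',r''$. From $(0,0)$ it moves to $(1,1)$ with probability $1$. (a) Assume $r<\min(p,q)$. Then $w=2+pqrw^3$ has a smallest positive solution $w$, and the chain has a unique stationary distribution $(p_{i,j})_{i,j\ge0}$. Moreover $$p_{0,0}=\frac{w(p-r)(q-r)|p-q|}{6pq(1-rw)\sqrt{1-pqw^2}}\ \text{ if } p\ne q,\qquad p_{0,0}=\tfrac13\,(1-r/p)^{3/2}\ \text{ if } p=q,$$ and, for complex $|x|,|y|\le 1$ (with absolutely convergent series), $$\sum_{i>0}p_{i,0}x^i=\frac1{r'}\bigl(Q(x,0)-Q(0,0)\bigr),\qquad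 \sum_{j>0}p_{0,j}y^j=\frac1{r''}\bigl(Q(0,y)-Q(0,0)\bigr),$$ $$\sum_{i,j>0}p_{i,j}x^iy^j=\frac1r\bigl(Q(x,y)-Q(x,0)-Q(0,y)+Q(0,0)\bigr).$$ Here $Q$ is the unique function on $\{|x|\le1,|y|\le1\}$ that is the sum of a power series in $x,y$ converging absolutely there, has $Q(0,0)=p_{0,0}$, and satisfies, for $x,y\neq 0$, $$\Bigl(1-\frac px-\frac qy-rxy\Bigr)Q(x,y)=q\Bigl(1-\frac1y\Bigr)Q(x,0)+p\Bigl(1-\frac1x\Bigr)Q(0,y).$$ It is given on the axes by $$Q(x,0)=\frac{Q(0,0)}{(1-qx/p)(1-rx/p)}\left(\Bigl(1-\frac x{pw}\Bigr)\sqrt{1-xqrw^2}-\frac{qx}p\Bigl(1-\frac1{qw}\Bigr)\sqrt{1-prw^2}\right)\quad(qx\ne p),$$ $$Q(0,y)=\frac{Q(0,0)}{(1-py/q)(1-ry/q)}\left(\Bigl(1-\frac y{qw}\Bigr)\sqrt{1-yprw^2}-\frac{py}q\Bigl(1-\frac1{pw}\Bigr)\sqrt{1-qrw^2}\right)\quad(py\ne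 q),$$ with principal square roots. When $p=q$ one has $w=1/p$ and $Q(x,0)=Q(0,x)=Q(0,0)/\sqrt{1-rx/p}$. (b) If $r\ge\min(p,q)$, the chain has no stationary distribution. -/

import Mathlib

/-- Transition probabilities `T (i, j) (k, l)` of the Markov chain on the quadrant `ℕ × ℕ`.
Interior points move West, South, North-East with probabilities `p`, `q`, `r`; points `(i, 0)`,
`i > 0`, move West or North-East with probabilities `p'`, `r'`; points `(0, j)`, `j > 0`, move
South or North-East with probabilities `q''`, `r''`; and `(0, 0)` moves to `(1, 1)`. -/
noncomputable def quadrantTransition (p q r p' r' q'' r'' : ℝ) : ℕ × ℕ → ℕ × ℕ → ℝ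
  | (0, 0), t => if t = (1, 1) then 1 else 0
  | (i + 1, 0), t => if t = (i, 0) then p' else if t = (i + 2, 1) then r' else 0
  | (0, j + 1), t => if t = (0, j) then q'' else if t = (1, j + 2) then r'' else 0
  | (i + 1, j + 1), t =>
      if t = (i, j + 1) then p
      else if t = (i + 1, j) then q
      else if t = (i + 2, j + 2) then r
      else 0

/-- `π` is a probability distribution on the countable set `S` that is stationary for the
transition probabilities `T`. -/
structure IsStationaryDistribution {S : Type*} (T : S → S → ℝ) (π : S → ℝ) : Prop where
  nonneg : ∀ s, 0 ≤ π s
  total : HasSum π 1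
  stationary : ∀ t, HasSum (fun s => π s * T s t) (π t)

/-- `Q` is, on the closed unit bidisc, the sum of a (necessarily absolutely) convergent power
series, hence analytic in the open unit bidisc, and it satisfies there the functional equation
`(1 - p/x - q/y - r x y) Q(x,y) = q (1 - 1/y) Q(x,0) + p (1 - 1/x) Q(0,y)`. -/
structure IsFlattoHahnSolution (p q r : ℝ) (Q : ℂ → ℂ → ℂ) : Prop where
  expansion : ∃ a : ℕ × ℕ → ℂ, ∀ x y : ℂ, ‖x‖ ≤ 1 → ‖y‖ ≤ 1 →
    HasSum (fun n : ℕ × ℕ => a n * x ^ n.1 * y ^ n.2) (Q x y)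
  equation : ∀ x y : ℂ, ‖x‖ ≤ 1 → ‖y‖ ≤ 1 → x ≠ 0 → y ≠ 0 →
    (1 - p / x - q / y - r * x * y) * Q x y =
      q * (1 - 1 / y) * Q x 0 + p * (1 - 1 / x) * Q 0 y

/-! Give each boundary state of the chain a loop in place of every step that would leave the
quadrant. The given ratios make the original chain the jump chain of this uniformized walk, so
stationary distributions are the normalized products of `boundaryWeight` with nonnegative summable
balanced arrays (`stationary_iff_isBalanced`), and the functional equation says that the
coefficients of `Q` are balanced (`isFlattoHahnSolution_iff`).

Uniqueness needs no analysis. The uniformized walk conserves mass, so the triangle inequality makes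
`‖a‖` balanced whenever the summable array `a` is; a nonnegative balanced array that vanishes at the
origin vanishes everywhere. Hence a summable balanced array is determined by its value at the origin
(`IsBalanced.eq_of_apply_zero_eq`), and a solution with positive origin value is automatically
nonnegative (`IsBalanced.eq_norm`). Column sums form a geometric progression of ratio `r / p`, which
excludes `r ≥ p`, and by symmetry `r ≥ q`.

For existence, solve the functional equation for `Q` with the explicit axis functions inserted. On
the kernel curve the roots `s = √(1 - xqrw²)` and `t = √(1 - yprw²)` satisfy `s t = 1 - rwxy`,
precisely because `w = 2 + pqrw³`; an algebraic identity then makes the numerator vanish wherever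
the kernel does (`numerator_eq_zero`). On a torus of radius slightly above `1` the quotient is
continuous, its Laurent coefficients of negative index vanish, and the others decay geometrically
and are balanced (`exists_isBalanced_of_kernel`). The cut equations give the normalizing constant.
-/

/-! ### Index shifts and axis restrictions of double series. -/

section DoubleSeries

variable {M : Type*}

/-- The array `a` moved by `(1, 1)`, with zeros on the axes. -/
def diagShift [Zero M] (a : ℕ × ℕ → M) : ℕ × ℕ → M
  | (i + 1, j + 1) => a (i, j)
  | (0, _) => 0
  | (_ + 1, 0) => 0

variable [AddCommGroup M] [TopologicalSpace M]

theorem hasSum_ite_fst_eq_zero {u : ℕ × ℕ → M} {s : M} :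
    HasSum (fun n : ℕ × ℕ => if n.1 = 0 then u n else 0) s ↔ HasSum (fun j => u (0, j)) s := by
  have hinj : Function.Injective (fun j : ℕ => ((0, j) : ℕ × ℕ)) := fun a b h => by simpa using h
  rw [← hinj.hasSum_iff]
  · simp [Function.comp_def]
  · rintro ⟨i, j⟩ h
    have : i ≠ 0 := by
      rintro rfl
      exact h ⟨j, rfl⟩
    simp [this]

theorem hasSum_ite_snd_eq_zero {u : ℕ × ℕ → M} {s : M} :
    HasSum (fun n : ℕ × ℕ => if n.2 = 0 then u n else 0) s ↔ HasSum (fun i => u (i, 0)) s := by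
  have hinj : Function.Injective (fun j : ℕ => ((j, 0) : ℕ × ℕ)) := fun a b h => by simpa using h
  rw [← hinj.hasSum_iff]
  · simp [Function.comp_def]
  · rintro ⟨i, j⟩ h
    have : j ≠ 0 := by
      rintro rfl
      exact h ⟨i, rfl⟩
    simp [this]

theorem hasSum_succ_fst [IsTopologicalAddGroup M] {u : ℕ × ℕ → M} {s t : M} (hu : HasSum u s)
    (ht : HasSum (fun j => u (0, j)) t) : HasSum (fun n : ℕ × ℕ => u (n.1 + 1, n.2)) (s - t) := by
  have hinj : Function.Injective (fun n : ℕ × ℕ => ((n.1 + 1, n.2) : ℕ × ℕ)) := by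
    rintro ⟨a, b⟩ ⟨c, d⟩ h
    simpa using h
  have h := hu.sub (hasSum_ite_fst_eq_zero.2 ht)
  rw [← hinj.hasSum_iff] at h
  · simpa [Function.comp_def] using h
  · rintro ⟨i, j⟩ h
    have : i = 0 := by
      rcases i with _ | i
      · rfl
      · exact absurd ⟨(i, j), rfl⟩ h
    simp [this]

theorem hasSum_succ_snd [IsTopologicalAddGroup M] {u : ℕ × ℕ → M} {s t : M} (hu : HasSum u s)
    (ht : HasSum (fun i => u (i, 0)) t) : HasSum (fun n : ℕ × ℕ => u (n.1, n.2 + 1)) (s - t) := by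
  have h := hasSum_succ_fst (u := fun n : ℕ × ℕ => u n.swap)
    ((Equiv.prodComm ℕ ℕ).hasSum_iff.2 hu) ht
  simpa [Function.comp_def] using (Equiv.prodComm ℕ ℕ).hasSum_iff.2 h

theorem hasSum_diagShift {u : ℕ × ℕ → M} {s : M} : HasSum (diagShift u) s ↔ HasSum u s := by
  have hinj : Function.Injective (fun n : ℕ × ℕ => ((n.1 + 1, n.2 + 1) : ℕ × ℕ)) := by
    rintro ⟨a, b⟩ ⟨c, d⟩ h
    simpa using h
  rw [← hinj.hasSum_iff]
  · simp [Function.comp_def, diagShift]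
  · rintro ⟨_ | i, _ | j⟩ h
    · rfl
    · rfl
    · rfl
    · exact absurd ⟨(i, j), rfl⟩ h

end DoubleSeries

/-! ### Balanced arrays: positivity, uniqueness and cut equations. -/

section Balance

/-- The flow into the state `n` of the uniformized quadrant walk with weights `a`: a step West
(South) out of the quadrant is replaced by a loop. -/
def inflow {M : Type*} [Semiring M] (p q r : M) (a : ℕ × ℕ → M) (n : ℕ × ℕ) : M :=
  p * (a (n.1 + 1, n.2) + if n.1 = 0 then a n else 0) +
    q * (a (n.1, n.2 + 1) + if n.2 = 0 then a n else 0) + r * diagShift a n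

/-- The weights `a` are invariant under the uniformized quadrant walk. -/
def IsBalanced {M : Type*} [Semiring M] (p q r : M) (a : ℕ × ℕ → M) : Prop :=
  ∀ n, inflow p q r a n = a n

theorem hasSum_inflow {M : Type*} [NormedField M] [CompleteSpace M] (p q r : M)
    {a : ℕ × ℕ → M} {s : M} (ha : HasSum a s) :
    HasSum (inflow p q r a) ((p + q + r) * s) := by
  obtain ⟨t, ht⟩ : Summable fun j => a (0, j) :=
    ha.summable.comp_injective fun a b h => by simpa using h
  obtain ⟨t', ht'⟩ : Summable fun i => a (i, 0) :=
    ha.summable.comp_injective fun a b h => by simpa using h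
  have h := ((((hasSum_succ_fst ha ht).add (hasSum_ite_fst_eq_zero.2 ht)).mul_left p).add
    (((hasSum_succ_snd ha ht').add (hasSum_ite_snd_eq_zero.2 ht')).mul_left q)).add
    ((hasSum_diagShift.2 ha).mul_left r)
  have e : p * (s - t + t) + q * (s - t' + t') + r * s = (p + q + r) * s := by ring
  rw [e] at h
  exact h

theorem norm_diagShift (a : ℕ × ℕ → ℂ) (n : ℕ × ℕ) :
    ‖diagShift a n‖ = diagShift (fun m => ‖a m‖) n := by
  rcases n with ⟨_ | i, _ | j⟩ <;> simp [diagShift]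

theorem diagShift_nonneg {b : ℕ × ℕ → ℝ} (hb : ∀ n, 0 ≤ b n) (n : ℕ × ℕ) :
    0 ≤ diagShift b n := by
  rcases n with ⟨_ | i, _ | j⟩ <;> simp [diagShift, hb]

theorem norm_inflow_le {p q r : ℝ} (hp : 0 ≤ p) (hq : 0 ≤ q) (hr : 0 ≤ r) (a : ℕ × ℕ → ℂ)
    (n : ℕ × ℕ) : ‖inflow (p : ℂ) q r a n‖ ≤ inflow p q r (fun m => ‖a m‖) n := by
  unfold inflow
  have hite : ∀ (c : Prop) [Decidable c], ‖if c then a n else 0‖ = if c then ‖a n‖ else 0 := by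
    intro c _
    split_ifs <;> simp
  refine (norm_add₃_le).trans ?_
  rw [norm_mul, norm_mul, norm_mul, Complex.norm_of_nonneg hp, Complex.norm_of_nonneg hq,
    Complex.norm_of_nonneg hr, norm_diagShift, ← hite, ← hite]
  gcongr <;> exact norm_add_le _ _

/-- The triangle inequality gives `‖a n‖ ≤ inflow ‖a‖ n` at each `n`, while both sides have the same
total because `p + q + r = 1`; so equality holds termwise. -/
theorem IsBalanced.norm {p q r : ℝ} (hp : 0 ≤ p) (hq : 0 ≤ q) (hr : 0 ≤ r) (hpqr : p + q + r = 1)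
    {a : ℕ × ℕ → ℂ} (ha : Summable a) (hb : IsBalanced (p : ℂ) q r a) :
    IsBalanced p q r fun n => ‖a n‖ := by
  obtain ⟨s, hs⟩ := ha.norm
  have h := (hasSum_inflow p q r hs).sub hs
  rw [hpqr, one_mul, sub_self] at h
  rw [hasSum_zero_iff_of_nonneg] at h
  · intro n
    simpa [sub_eq_zero] using congrFun h n
  · intro n
    have := norm_inflow_le hp hq hr a n
    rw [hb n] at this
    simpa using this

/-- A state of zero weight receives zero flow, so its East and North neighbours also have weight
zero; these two directions reach the whole quadrant from the origin. -/
theorem IsBalanced.eq_zero_of_nonneg {p q r : ℝ} (hp : 0 < p) (hq : 0 < q) (hr : 0 ≤ r)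
    {b : ℕ × ℕ → ℝ} (hb : IsBalanced p q r b) (hn : ∀ n, 0 ≤ b n) (h0 : b (0, 0) = 0) : b = 0 := by
  have key : ∀ n : ℕ × ℕ, b n = 0 → b (n.1 + 1, n.2) = 0 ∧ b (n.1, n.2 + 1) = 0 := by
    intro n h
    have hbn := hb n
    unfold inflow at hbn
    rw [h] at hbn
    have h1 := mul_nonneg hp.le (hn (n.1 + 1, n.2))
    have h2 := mul_nonneg hq.le (hn (n.1, n.2 + 1))
    have h3 := mul_nonneg hr (diagShift_nonneg hn n)
    simp only [ite_self, add_zero] at hbn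
    have h4 : p * b (n.1 + 1, n.2) = 0 := by linarith
    have h5 : q * b (n.1, n.2 + 1) = 0 := by linarith
    exact ⟨(mul_eq_zero.1 h4).resolve_left hp.ne', (mul_eq_zero.1 h5).resolve_left hq.ne'⟩
  have hi : ∀ i, b (i, 0) = 0 := by
    intro i
    induction i with
    | zero => exact h0
    | succ i ih => exact (key _ ih).1
  funext ⟨i, j⟩
  induction j with
  | zero => exact hi i
  | succ j ih => exact (key _ ih).2

theorem diagShift_sub (a b : ℕ × ℕ → ℂ) (n : ℕ × ℕ) :
    diagShift (a - b) n = diagShift a n - diagShift b n := by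
  rcases n with ⟨_ | i, _ | j⟩ <;> simp [diagShift]

theorem diagShift_smul (c : ℂ) (a : ℕ × ℕ → ℂ) (n : ℕ × ℕ) :
    diagShift (c • a) n = c * diagShift a n := by
  rcases n with ⟨_ | i, _ | j⟩ <;> simp [diagShift]

theorem diagShift_ofReal (b : ℕ × ℕ → ℝ) (n : ℕ × ℕ) :
    diagShift (fun m => (b m : ℂ)) n = (diagShift b n : ℝ) := by
  rcases n with ⟨_ | i, _ | j⟩ <;> simp [diagShift]

theorem IsBalanced.sub {p q r : ℂ} {a b : ℕ × ℕ → ℂ} (ha : IsBalanced p q r a)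
    (hb : IsBalanced p q r b) : IsBalanced p q r (a - b) := by
  intro n
  have h1 := ha n
  have h2 := hb n
  rw [Pi.sub_apply, ← h1, ← h2]
  unfold inflow
  rw [diagShift_sub]
  simp only [Pi.sub_apply]
  split_ifs <;> ring

theorem IsBalanced.smul {p q r : ℂ} {a : ℕ × ℕ → ℂ} (ha : IsBalanced p q r a) (c : ℂ) :
    IsBalanced p q r (c • a) := by
  intro n
  rw [Pi.smul_apply, ← ha n]
  unfold inflow
  rw [diagShift_smul]
  simp only [Pi.smul_apply, smul_eq_mul]
  split_ifs <;> ring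

theorem isBalanced_ofReal {p q r : ℝ} {b : ℕ × ℕ → ℝ} :
    IsBalanced (p : ℂ) q r (fun n => (b n : ℂ)) ↔ IsBalanced p q r b := by
  refine forall_congr' fun n => ?_
  rw [← Complex.ofReal_inj]
  unfold inflow
  rw [diagShift_ofReal]
  split_ifs <;> push_cast <;> rfl

theorem IsBalanced.eq_zero {p q r : ℝ} (hp : 0 < p) (hq : 0 < q) (hr : 0 ≤ r)
    (hpqr : p + q + r = 1) {a : ℕ × ℕ → ℂ} (ha : Summable a) (hb : IsBalanced (p : ℂ) q r a)
    (h0 : a (0, 0) = 0) : a = 0 := by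
  have h := (hb.norm hp.le hq.le hr hpqr ha).eq_zero_of_nonneg hp hq hr (fun _ => norm_nonneg _)
    (by simp [h0])
  funext n
  simpa using congrFun h n

theorem IsBalanced.eq_of_apply_zero_eq {p q r : ℝ} (hp : 0 < p) (hq : 0 < q) (hr : 0 ≤ r)
    (hpqr : p + q + r = 1) {a b : ℕ × ℕ → ℂ} (ha : Summable a) (hb : Summable b)
    (hab : IsBalanced (p : ℂ) q r a) (hbb : IsBalanced (p : ℂ) q r b)
    (h0 : a (0, 0) = b (0, 0)) : a = b :=
  sub_eq_zero.1 ((hab.sub hbb).eq_zero hp hq hr hpqr (ha.sub hb) (by simp [h0]))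

/-- Both `a` and `‖a‖` are balanced with the same origin value, so uniqueness identifies them. This
yields nonnegativity of a solution found by complex analysis. -/
theorem IsBalanced.eq_norm {p q r : ℝ} (hp : 0 < p) (hq : 0 < q) (hr : 0 ≤ r)
    (hpqr : p + q + r = 1) {a : ℕ × ℕ → ℂ} (ha : Summable a) (hb : IsBalanced (p : ℂ) q r a)
    (h0 : a (0, 0) = (‖a (0, 0)‖ : ℝ)) : a = fun n => ((‖a n‖ : ℝ) : ℂ) :=
  hb.eq_of_apply_zero_eq hp hq hr hpqr ha (Complex.hasSum_ofReal.2 ha.norm.hasSum).summable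
    (isBalanced_ofReal.2 (hb.norm hp.le hq.le hr hpqr ha)) h0

/-- The cut equation: the mass of the column `i + 1` times `p` is the mass of the column `i`
times `r`. -/
theorem IsBalanced.hasSum_column {p q r : ℝ} (hp : p ≠ 0) (hpqr : p + q + r = 1)
    {a : ℕ × ℕ → ℂ} (ha : Summable a) (hb : IsBalanced (p : ℂ) q r a) (i : ℕ) :
    HasSum (fun j => a (i, j)) ((r / p : ℂ) ^ i * ∑' j, a (0, j)) := by
  have hp' : (p : ℂ) ≠ 0 := by exact_mod_cast hp
  have hpqr' : (p + q + r : ℂ) = 1 := by exact_mod_cast hpqr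
  have hs : ∀ i, HasSum (fun j => a (i, j)) (∑' j, a (i, j)) := fun i =>
    Summable.hasSum (ha.comp_injective fun a b h => by simpa using h)
  have hsucc : ∀ i, HasSum (fun j => a (i, j + 1)) (∑' j, a (i, j) - a (i, 0)) := fun i => by
    have := (hasSum_nat_add_iff' (f := fun j => a (i, j)) 1).2 (hs i)
    simpa using this
  have hz : ∀ i, HasSum (fun j => if j = 0 then a (i, j) else 0) (a (i, 0)) := fun i => by
    have := hasSum_ite_eq (0 : ℕ) (a (i, 0))
    refine this.congr_fun fun j => ?_
    by_cases h : j = 0 <;> simp [h]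
  -- Summing the balance over a column cancels the vertical steps; what remains says that the net
  -- flow between neighbouring columns is constant in `i`, and it is zero at the wall.
  have key : ∀ i, (p : ℂ) * ∑' j, a (i + 1, j) = r * ∑' j, a (i, j) := by
    intro i
    induction i with
    | zero =>
      have h := (((hs 1).add (hs 0)).mul_left (p : ℂ)).add
        (((hsucc 0).add (hz 0)).mul_left (q : ℂ))
      have h' : HasSum (fun j => a (0, j)) _ := h.congr_fun fun j => 
        (hb (0, j)).symm.trans (by simp [inflow, diagShift])
      have := h'.unique (hs 0)
      linear_combination this - (∑' j, a (0, j)) * hpqr'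
    | succ i ih =>
      have hd : HasSum (fun j => diagShift a (i + 1, j)) (∑' j, a (i, j)) := by
        rw [← hasSum_nat_add_iff' 1]
        simpa [diagShift] using hs i
      have h := (((hs (i + 2)).mul_left (p : ℂ)).add
        (((hsucc (i + 1)).add (hz (i + 1))).mul_left (q : ℂ))).add (hd.mul_left (r : ℂ))
      have h' : HasSum (fun j => a (i + 1, j)) _ := h.congr_fun fun j => 
        (hb (i + 1, j)).symm.trans (by simp [inflow])
      have := h'.unique (hs (i + 1))
      linear_combination this - (∑' j, a (i + 1, j)) * hpqr' + ih
  have : ∀ i, ∑' j, a (i, j) = (r / p : ℂ) ^ i * ∑' j, a (0, j) := by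
    intro i
    induction i with
    | zero => simp
    | succ i ih =>
      have := key i
      rw [ih] at this
      rw [pow_succ]
      field_simp
      field_simp at this
      linear_combination this
  rw [← this i]
  exact hs i

theorem IsBalanced.hasSum_mul_sub {p q r : ℝ} (hp : p ≠ 0) (hpqr : p + q + r = 1)
    {a : ℕ × ℕ → ℂ} {s t : ℂ} (ha : HasSum a s) (hb : IsBalanced (p : ℂ) q r a)
    (ht : HasSum (fun j => a (0, j)) t) (hrp : |r| < |p|) : (p - r) * s = p * t := by
  have hp' : (p : ℂ) ≠ 0 := by exact_mod_cast hp
  have h1 := ha.prod_fiberwise (hb.hasSum_column hp hpqr ha.summable)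
  rw [ht.tsum_eq] at h1
  have hlt : ‖(r / p : ℂ)‖ < 1 := by
    rw [norm_div, Complex.norm_real, Complex.norm_real, Real.norm_eq_abs, Real.norm_eq_abs,
      div_lt_one (abs_pos.2 hp)]
    exact hrp
  have h2 := (hasSum_geometric_of_norm_lt_one hlt).mul_right t
  rw [h1.unique h2]
  have : (p - r : ℂ) ≠ 0 := by
    intro h
    have : (p : ℝ) = r := by exact_mod_cast sub_eq_zero.1 h
    exact hrp.ne (by rw [this])
  have h3 : (1 - r / p : ℂ) ≠ 0 := by
    rw [one_sub_div hp']
    exact div_ne_zero this hp'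
  field_simp

/-- The column sums are summable multiples of powers of `r / p ≥ 1`, so column `0`, and with it
every column, has sum zero. -/
theorem IsBalanced.eq_zero_of_le {p q r : ℝ} (hp : 0 < p) (hpqr : p + q + r = 1) (hpr : p ≤ r)
    {a : ℕ × ℕ → ℂ} (ha : Summable a) (hb : IsBalanced (p : ℂ) q r a) :
    ∑' n, a n = 0 := by
  have h1 := ha.hasSum.prod_fiberwise (hb.hasSum_column hp.ne' hpqr ha)
  by_cases h0 : ∑' j, a (0, j) = 0
  · simp only [h0, mul_zero] at h1
    exact h1.unique hasSum_zero
  · have h2 := (summable_mul_right_iff h0).1 h1.summable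
    rw [summable_geometric_iff_norm_lt_one, norm_div, Complex.norm_real, Complex.norm_real,
      Real.norm_of_nonneg hp.le, Real.norm_of_nonneg (hp.le.trans hpr), div_lt_one hp] at h2
    exact absurd h2 hpr.not_gt

theorem diagShift_swap (a : ℕ × ℕ → ℂ) (n : ℕ × ℕ) :
    diagShift (fun m => a m.swap) n = diagShift a n.swap := by
  rcases n with ⟨_ | i, _ | j⟩ <;> simp [diagShift]

theorem IsBalanced.swap {p q r : ℂ} {a : ℕ × ℕ → ℂ} (ha : IsBalanced p q r a) :
    IsBalanced q p r fun n => a n.swap := by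
  intro n
  simp only [← ha n.swap]
  unfold inflow
  rw [diagShift_swap]
  simp only [Prod.fst_swap, Prod.snd_swap, Prod.swap_prod_mk]
  ring

end Balance

/-! ### The quadrant chain as the jump chain of the uniformized walk. -/

section Chain

/-- The quotient of the stationary probability at `n` by the weight of `n` for the uniformized
walk. -/
noncomputable def boundaryWeight (p q r : ℝ) (n : ℕ × ℕ) : ℝ :=
  (1 - (if n.1 = 0 then p else 0) - (if n.2 = 0 then q else 0)) / r

theorem boundaryWeight_pos {p q r : ℝ} (hp : 0 < p) (hq : 0 < q) (hr : 0 < r)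
    (hpqr : p + q + r = 1) (n : ℕ × ℕ) : 0 < boundaryWeight p q r n := by
  unfold boundaryWeight
  apply div_pos _ hr
  split_ifs <;> linarith

theorem boundaryWeight_zero_zero {p q r : ℝ} (hr : 0 < r) (hpqr : p + q + r = 1) :
    boundaryWeight p q r (0, 0) = 1 := by
  simp only [boundaryWeight, if_true]
  rw [div_eq_one_iff_eq hr.ne']
  linarith

theorem boundaryWeight_succ_zero {p q r p' r' : ℝ} (hr : 0 < r) (hpqr : p + q + r = 1)
    (hr' : 0 < r') (hpr' : p' + r' = 1) (hα : p / r = p' / r') (i : ℕ) :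
    boundaryWeight p q r (i + 1, 0) = 1 / r' := by
  simp only [boundaryWeight, if_true, Nat.succ_ne_zero, if_false]
  rw [div_eq_div_iff hr.ne' hr'.ne'] at hα ⊢
  linear_combination hα + r * hpr' - r' * hpqr

theorem boundaryWeight_zero_succ {p q r q'' r'' : ℝ} (hr : 0 < r) (hpqr : p + q + r = 1)
    (hr'' : 0 < r'') (hqr'' : q'' + r'' = 1) (hβ : q / r = q'' / r'') (j : ℕ) :
    boundaryWeight p q r (0, j + 1) = 1 / r'' := by
  simp only [boundaryWeight, if_true, Nat.succ_ne_zero, if_false]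
  rw [div_eq_div_iff hr.ne' hr''.ne'] at hβ ⊢
  linear_combination hβ + r * hqr'' - r'' * hpqr

theorem boundaryWeight_succ_succ (p q r : ℝ) (i j : ℕ) :
    boundaryWeight p q r (i + 1, j + 1) = 1 / r := by
  simp [boundaryWeight]

theorem hasSum_ite_eq_diagShift {M : Type*} [AddCommMonoid M] [TopologicalSpace M]
    (a : ℕ × ℕ → M) (t : ℕ × ℕ) :
    HasSum (fun s : ℕ × ℕ => if t = (s.1 + 1, s.2 + 1) then a s else 0) (diagShift a t) := by
  rcases t with ⟨_ | k, _ | l⟩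
  · simp [diagShift]
  · simp [diagShift]
  · simp [diagShift]
  · refine (hasSum_ite_eq (k, l) (a (k, l))).congr_fun fun s => ?_
    rcases s with ⟨i, j⟩
    by_cases h : (i, j) = (k, l)
    · obtain ⟨rfl, rfl⟩ := Prod.mk.inj h
      simp
    · have : ¬ (k + 1, l + 1) = (i + 1, j + 1) := by
        simp only [Prod.mk.injEq, add_left_inj] at h ⊢
        tauto
      simp [h, this]

variable {p q r p' r' q'' r'' : ℝ} (hr : 0 < r) (hpqr : p + q + r = 1)
  (hr' : 0 < r') (hpr' : p' + r' = 1) (hr'' : 0 < r'') (hqr'' : q'' + r'' = 1)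
  (hα : p / r = p' / r') (hβ : q / r = q'' / r'')
include hr hpqr hr' hpr' hr'' hqr'' hα hβ

/-- The weight is the probability of not looping, divided by `r`. Multiplying by it removes the
boundary cases: every state sends the same rates `p / r`, `q / r`, `1` along those steps that stay
in the quadrant. -/
theorem boundaryWeight_mul_quadrantTransition (s t : ℕ × ℕ) :
    boundaryWeight p q r s * quadrantTransition p q r p' r' q'' r'' s t =
      (if s = (t.1 + 1, t.2) then p / r else 0) + (if s = (t.1, t.2 + 1) then q / r else 0) +
        (if t = (s.1 + 1, s.2 + 1) then 1 else 0) := by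
  have e1 : 1 / r' * p' = p / r := by rw [hα]; ring
  have e2 : 1 / r'' * q'' = q / r := by rw [hβ]; ring
  rcases t with ⟨k, l⟩
  rcases s with ⟨_ | i, _ | j⟩
  · rw [boundaryWeight_zero_zero hr hpqr]
    simp [quadrantTransition]
  · rw [boundaryWeight_zero_succ hr hpqr hr'' hqr'' hβ]
    simp only [quadrantTransition, mul_ite, e2, mul_zero, one_div_mul_cancel hr''.ne']
    grind
  · rw [boundaryWeight_succ_zero hr hpqr hr' hpr' hα]
    simp only [quadrantTransition, mul_ite, e1, mul_zero, one_div_mul_cancel hr'.ne']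
    grind
  · rw [boundaryWeight_succ_succ]
    simp only [quadrantTransition, mul_ite, mul_zero, one_div_mul_cancel hr.ne',
      one_div_mul_eq_div]
    grind

theorem hasSum_mul_quadrantTransition (a : ℕ × ℕ → ℝ) (t : ℕ × ℕ) :
    HasSum (fun s => boundaryWeight p q r s * a s * quadrantTransition p q r p' r' q'' r'' s t)
      (p / r * a (t.1 + 1, t.2) + q / r * a (t.1, t.2 + 1) + diagShift a t) := by
  refine (((hasSum_ite_eq (t.1 + 1, t.2) (p / r * a (t.1 + 1, t.2))).add
    (hasSum_ite_eq (t.1, t.2 + 1) (q / r * a (t.1, t.2 + 1)))).add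
    (hasSum_ite_eq_diagShift a t)).congr_fun fun s => ?_
  rw [mul_right_comm, boundaryWeight_mul_quadrantTransition hr hpqr hr' hpr' hr'' hqr'' hα hβ,
    add_mul, add_mul]
  simp only [ite_mul, one_mul, zero_mul]
  congr 2
  · split_ifs with h <;> simp [h]
  · split_ifs with h <;> simp [h]

theorem stationary_iff_isBalanced (a : ℕ × ℕ → ℝ) :
    (∀ t, HasSum (fun s => boundaryWeight p q r s * a s *
        quadrantTransition p q r p' r' q'' r'' s t) (boundaryWeight p q r t * a t)) ↔
      IsBalanced p q r a := by
  refine forall_congr' fun t => ?_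
  have h := hasSum_mul_quadrantTransition hr hpqr hr' hpr' hr'' hqr'' hα hβ a t
  trans p / r * a (t.1 + 1, t.2) + q / r * a (t.1, t.2 + 1) + diagShift a t =
    boundaryWeight p q r t * a t
  · exact ⟨fun h' => h.unique h', fun e => e ▸ h⟩
  · unfold inflow boundaryWeight
    field_simp
    constructor <;> intro e <;> split_ifs at e ⊢ <;> linear_combination e

end Chain

/-! ### Uniqueness and nonexistence of stationary distributions. -/

section Stationary

theorem one_le_boundaryWeight {p q r : ℝ} (hp : 0 < p) (hq : 0 < q) (hr : 0 < r)
    (hpqr : p + q + r = 1) (n : ℕ × ℕ) : 1 ≤ boundaryWeight p q r n := by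
  unfold boundaryWeight
  rw [le_div_iff₀ hr]
  split_ifs <;> linarith

theorem hasSum_boundaryWeight_mul {p q r : ℝ} {a : ℕ × ℕ → ℝ} {s t u : ℝ} (hs : HasSum a s)
    (ht : HasSum (fun j => a (0, j)) t) (hu : HasSum (fun i => a (i, 0)) u) :
    HasSum (fun n => boundaryWeight p q r n * a n) ((s - p * t - q * u) / r) := by
  refine (((hs.sub ((hasSum_ite_fst_eq_zero.2 ht).mul_left p)).sub
    ((hasSum_ite_snd_eq_zero.2 hu).mul_left q)).div_const r).congr_fun fun n => ?_
  unfold boundaryWeight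
  split_ifs <;> ring

variable {p q r p' r' q'' r'' : ℝ} (hp : 0 < p) (hq : 0 < q) (hr : 0 < r) (hpqr : p + q + r = 1)
  (hr' : 0 < r') (hpr' : p' + r' = 1) (hr'' : 0 < r'') (hqr'' : q'' + r'' = 1)
  (hα : p / r = p' / r') (hβ : q / r = q'' / r'')
include hp hq hr hpqr hr' hpr' hr'' hqr'' hα hβ

theorem IsStationaryDistribution.exists_isBalanced {π : ℕ × ℕ → ℝ}
    (hπ : IsStationaryDistribution (quadrantTransition p q r p' r' q'' r'') π) :
    ∃ a : ℕ × ℕ → ℝ, (∀ n, 0 ≤ a n) ∧ Summable a ∧ IsBalanced p q r a ∧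
      ∀ n, π n = boundaryWeight p q r n * a n := by
  have hw := boundaryWeight_pos hp hq hr hpqr
  have e : ∀ n, π n = boundaryWeight p q r n * (π n / boundaryWeight p q r n) := fun n => by
    rw [mul_div_cancel₀ _ (hw n).ne']
  refine ⟨fun n => π n / boundaryWeight p q r n, fun n => div_nonneg (hπ.nonneg n) (hw n).le,
    ?_, ?_, e⟩
  · refine Summable.of_nonneg_of_le (fun n => div_nonneg (hπ.nonneg n) (hw n).le)
      (fun n => ?_) hπ.total.summable
    exact div_le_self (hπ.nonneg n) (one_le_boundaryWeight hp hq hr hpqr n)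
  · rw [← stationary_iff_isBalanced hr hpqr hr' hpr' hr'' hqr'' hα hβ]
    intro t
    simp only [← e]
    exact hπ.stationary t

theorem IsStationaryDistribution.unique {π π' : ℕ × ℕ → ℝ}
    (hπ : IsStationaryDistribution (quadrantTransition p q r p' r' q'' r'') π)
    (hπ' : IsStationaryDistribution (quadrantTransition p q r p' r' q'' r'') π') : π' = π := by
  obtain ⟨a, -, has, hab, ha⟩ := hπ.exists_isBalanced hp hq hr hpqr hr' hpr' hr'' hqr'' hα hβ
  obtain ⟨b, -, hbs, hbb, hb⟩ := hπ'.exists_isBalanced hp hq hr hpqr hr' hpr' hr'' hqr'' hα hβ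
  have has' : Summable fun n => (a n : ℂ) := (Complex.hasSum_ofReal.2 has.hasSum).summable
  have hbs' : Summable fun n => (b n : ℂ) := (Complex.hasSum_ofReal.2 hbs.hasSum).summable
  have hab' := isBalanced_ofReal.2 hab
  have hbb' := isBalanced_ofReal.2 hbb
  have ha0 : (a (0, 0) : ℂ) ≠ 0 := by
    intro h0
    have h := hab'.eq_zero hp hq hr.le hpqr has' h0
    have hz : π = 0 := by
      funext n
      have := congrFun h n
      rw [ha n]
      simp only [Pi.zero_apply, Complex.ofReal_eq_zero] at this
      simp [this]
    have := hπ.total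
    rw [hz] at this
    exact zero_ne_one (hasSum_zero.unique this)
  have h := hbb'.eq_of_apply_zero_eq hp hq hr.le hpqr hbs'
    (has'.mul_left ((b (0, 0) : ℂ) / a (0, 0))) (hab'.smul ((b (0, 0) : ℂ) / a (0, 0)))
    (by simp [ha0])
  have hc : ∀ n, π' n = b (0, 0) / a (0, 0) * π n := by
    intro n
    have := congrFun h n
    rw [ha, hb]
    have e : b n = b (0, 0) / a (0, 0) * a n := by
      have : (b n : ℂ) = b (0, 0) / a (0, 0) * a n := this
      exact_mod_cast this
    rw [e]
    ring
  -- The two distributions are proportional and both have total mass `1`.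
  have h1 : b (0, 0) / a (0, 0) = 1 := by
    have := (hπ.total.mul_left (b (0, 0) / a (0, 0))).unique (hπ'.total.congr_fun fun n => (hc n).symm)
    simpa using this
  funext n
  rw [hc, h1, one_mul]

theorem not_isStationaryDistribution_of_le (h : min p q ≤ r) (π : ℕ × ℕ → ℝ) :
    ¬ IsStationaryDistribution (quadrantTransition p q r p' r' q'' r'') π := by
  intro hπ
  obtain ⟨a, ha0, has, hab, ha⟩ := hπ.exists_isBalanced hp hq hr hpqr hr' hpr' hr'' hqr'' hα hβ
  have has' : Summable fun n => (a n : ℂ) := (Complex.hasSum_ofReal.2 has.hasSum).summable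
  have hab' := isBalanced_ofReal.2 hab
  have hz : ∑' n, (a n : ℂ) = 0 := by
    rcases min_le_iff.1 h with h | h
    · exact hab'.eq_zero_of_le hp hpqr h has'
    · have := hab'.swap.eq_zero_of_le hq (by linarith) h
        ((Equiv.prodComm ℕ ℕ).summable_iff.2 has')
      rw [← this]
      exact ((Equiv.prodComm ℕ ℕ).tsum_eq _).symm
  have hz' : HasSum a 0 := by
    rw [← Complex.hasSum_ofReal]
    simpa [hz] using has'.hasSum
  rw [hasSum_zero_iff_of_nonneg ha0] at hz'
  have h0 : π = 0 := funext fun n => by simp [ha, hz']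
  have := hπ.total
  rw [h0] at this
  exact zero_ne_one (hasSum_zero.unique this)

end Stationary

/-! ### The functional equation as balance of coefficients. -/

section PowerSeries

/-- The point `0` is excluded because the functional equation has poles on the axes; continuity of
the sum recovers the value there, and uniqueness of power series applies. -/
theorem eq_zero_of_hasSum_pow_eq_zero {c : ℕ → ℂ} (hc : Summable c)
    (h : ∀ x : ℂ, x ≠ 0 → ‖x‖ ≤ 1 → HasSum (fun i => c i * x ^ i) 0) : c = 0 := by
  let P : FormalMultilinearSeries ℂ ℂ ℂ := FormalMultilinearSeries.ofScalars ℂ c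
  have hr : (1 : ENNReal) ≤ P.radius := by
    apply P.le_radius_of_summable_norm (r := 1)
    have := hc.norm
    simpa [P, FormalMultilinearSeries.ofScalars_norm] using this
  have hP : HasFPowerSeriesOnBall P.sum P 0 1 :=
    (P.hasFPowerSeriesOnBall (zero_lt_one.trans_le hr)).mono zero_lt_one hr
  have hsum : ∀ x : ℂ, x ≠ 0 → ‖x‖ < 1 → P.sum x = 0 := by
    intro x hx hx1
    rw [← (h x hx hx1.le).tsum_eq]
    simp [FormalMultilinearSeries.sum, P, mul_comm]
  have hev : ∀ᶠ x in nhdsWithin (0 : ℂ) {0}ᶜ, P.sum x = 0 := by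
    have : ∀ᶠ x in nhdsWithin (0 : ℂ) {0}ᶜ, ‖x‖ < 1 := by
      apply Filter.Eventually.filter_mono nhdsWithin_le_nhds
      filter_upwards [Metric.ball_mem_nhds (0 : ℂ) one_pos] with x hx
      simpa using hx
    filter_upwards [this, self_mem_nhdsWithin] with x h1 h2
    exact hsum x h2 h1
  have h0 : P.sum 0 = 0 := by
    have hcont : ContinuousAt P.sum 0 := hP.hasFPowerSeriesAt.continuousAt
    refine tendsto_nhds_unique (hcont.tendsto.mono_left nhdsWithin_le_nhds) ?_
      (l := nhdsWithin (0 : ℂ) {0}ᶜ)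
    exact (tendsto_const_nhds (x := (0 : ℂ))).congr' (hev.mono fun x hx => hx.symm)
  have hfin : HasFPowerSeriesAt (0 : ℂ → ℂ) P 0 := by
    refine hP.hasFPowerSeriesAt.congr ?_
    filter_upwards [Metric.ball_mem_nhds (0 : ℂ) one_pos] with x hx
    by_cases hx0 : x = 0
    · simp [hx0, h0]
    · exact hsum x hx0 (by simpa using hx)
  have hz := hfin.eq_zero
  funext i
  have : P.coeff i = 0 := by simp [hz, FormalMultilinearSeries.coeff]
  simpa [P, FormalMultilinearSeries.coeff_ofScalars] using this

theorem eq_zero_of_hasSum_pow_mul_pow_eq_zero {d : ℕ × ℕ → ℂ} (hd : Summable d)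
    (h : ∀ x y : ℂ, x ≠ 0 → y ≠ 0 → ‖x‖ ≤ 1 → ‖y‖ ≤ 1 →
      HasSum (fun n : ℕ × ℕ => d n * x ^ n.1 * y ^ n.2) 0) : d = 0 := by
  have hrow : ∀ (y : ℂ), ‖y‖ ≤ 1 → ∀ i, Summable fun j => d (i, j) * y ^ j := by
    intro y hy i
    refine Summable.of_norm_bounded (hd.comp_injective (i := fun j : ℕ => ((i, j) : ℕ × ℕ))
      fun a b h => by simpa using h).norm fun j => ?_
    rw [norm_mul, norm_pow]
    exact mul_le_of_le_one_right (norm_nonneg _) (pow_le_one₀ (norm_nonneg _) hy)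
  have key : ∀ y : ℂ, y ≠ 0 → ‖y‖ ≤ 1 → ∀ i, HasSum (fun j => d (i, j) * y ^ j) 0 := by
    intro y hy0 hy i
    have hs : Summable fun n : ℕ × ℕ => d n * y ^ n.2 := by
      refine Summable.of_norm_bounded hd.norm fun n => ?_
      rw [norm_mul, norm_pow]
      exact mul_le_of_le_one_right (norm_nonneg _) (pow_le_one₀ (norm_nonneg _) hy)
    have hz : (fun i => ∑' j, d (i, j) * y ^ j) = 0 := by
      apply eq_zero_of_hasSum_pow_eq_zero
      · exact (hs.hasSum.prod_fiberwise fun i => (hrow y hy i).hasSum).summable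
      · intro x hx0 hx
        refine (h x y hx0 hy0 hx hy).prod_fiberwise fun i => ?_
        refine ((hrow y hy i).hasSum.mul_right (x ^ i)).congr_fun fun j => ?_
        ring
    have := congrFun hz i
    simp only [Pi.zero_apply] at this
    rw [← this]
    exact (hrow y hy i).hasSum
  funext ⟨i, j⟩
  have := eq_zero_of_hasSum_pow_eq_zero (c := fun j => d (i, j))
    (hd.comp_injective fun a b h => by simpa using h) fun y hy0 hy => key y hy0 hy i
  exact congrFun this j

theorem HasSum.pow_mul_pow_zero_right {a : ℕ × ℕ → ℂ} {x s : ℂ}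
    (h : HasSum (fun n : ℕ × ℕ => a n * x ^ n.1 * 0 ^ n.2) s) :
    HasSum (fun i => a (i, 0) * x ^ i) s := by
  rw [← hasSum_ite_snd_eq_zero (u := fun n : ℕ × ℕ => a n * x ^ n.1)]
  refine h.congr_fun fun n => ?_
  split_ifs with h <;> simp [h]

theorem HasSum.pow_mul_pow_zero_left {a : ℕ × ℕ → ℂ} {y s : ℂ}
    (h : HasSum (fun n : ℕ × ℕ => a n * 0 ^ n.1 * y ^ n.2) s) :
    HasSum (fun j => a (0, j) * y ^ j) s := by
  rw [← hasSum_ite_fst_eq_zero (u := fun n : ℕ × ℕ => a n * y ^ n.2)]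
  refine h.congr_fun fun n => ?_
  split_ifs with h <;> simp [h]

theorem summable_of_hasSum_pow_mul_pow {Q : ℂ → ℂ → ℂ} {a : ℕ × ℕ → ℂ}
    (ha : ∀ x y : ℂ, ‖x‖ ≤ 1 → ‖y‖ ≤ 1 →
      HasSum (fun n : ℕ × ℕ => a n * x ^ n.1 * y ^ n.2) (Q x y)) : Summable a := by
  simpa using (ha 1 1 (by simp) (by simp)).summable

/-- Dividing by `x` or `y` shifts indices and loses one axis, while the loops put that axis back
without the division; hence the factors `1 - 1/x` and `1 - 1/y`. -/
theorem hasSum_inflow_sub_self {p q r : ℂ} {Q : ℂ → ℂ → ℂ} {a : ℕ × ℕ → ℂ}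
    (ha : ∀ x y : ℂ, ‖x‖ ≤ 1 → ‖y‖ ≤ 1 →
      HasSum (fun n : ℕ × ℕ => a n * x ^ n.1 * y ^ n.2) (Q x y)) {x y : ℂ} (hx : ‖x‖ ≤ 1)
    (hy : ‖y‖ ≤ 1) (hx0 : x ≠ 0) (hy0 : y ≠ 0) :
    HasSum (fun n : ℕ × ℕ => (inflow p q r a n - a n) * x ^ n.1 * y ^ n.2)
      (q * (1 - 1 / y) * Q x 0 + p * (1 - 1 / x) * Q 0 y -
        (1 - p / x - q / y - r * x * y) * Q x y) := by
  let u : ℕ × ℕ → ℂ := fun n => a n * x ^ n.1 * y ^ n.2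
  have hu : HasSum u (Q x y) := ha x y hx hy
  have hu0 : HasSum (fun j => u (0, j)) (Q 0 y) := by
    simpa [u] using (ha 0 y (by simp) hy).pow_mul_pow_zero_left
  have hu1 : HasSum (fun i => u (i, 0)) (Q x 0) := by
    simpa [u] using (ha x 0 hx (by simp)).pow_mul_pow_zero_right
  have h := ((((((hasSum_succ_fst hu hu0).mul_left (1 / x)).add
    (hasSum_ite_fst_eq_zero.2 hu0)).mul_left p).add
    ((((hasSum_succ_snd hu hu1).mul_left (1 / y)).add
    (hasSum_ite_snd_eq_zero.2 hu1)).mul_left q)).add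
    ((hasSum_diagShift.2 hu).mul_left (r * x * y))).sub hu
  have hd : ∀ n, x * y * diagShift u n = diagShift a n * x ^ n.1 * y ^ n.2 := by
    rintro ⟨_ | i, _ | j⟩ <;> simp [diagShift, u]
    ring
  have h' := h.congr_fun (g := fun n : ℕ × ℕ => (inflow p q r a n - a n) * x ^ n.1 * y ^ n.2)
    fun n => by
      rw [mul_assoc r, mul_assoc r, hd]
      simp only [inflow, u]
      split_ifs <;> field_simp <;> ring
  have e : p * (1 / x * (Q x y - Q 0 y) + Q 0 y) + q * (1 / y * (Q x y - Q x 0) + Q x 0) +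
      r * x * y * Q x y - Q x y = q * (1 - 1 / y) * Q x 0 + p * (1 - 1 / x) * Q 0 y -
        (1 - p / x - q / y - r * x * y) * Q x y := by ring
  rwa [e] at h'

/-- The functional equation for a power series in two variables says that its coefficients are
balanced. -/
theorem isFlattoHahnSolution_iff {p q r : ℝ} {Q : ℂ → ℂ → ℂ} {a : ℕ × ℕ → ℂ}
    (ha : ∀ x y : ℂ, ‖x‖ ≤ 1 → ‖y‖ ≤ 1 →
      HasSum (fun n : ℕ × ℕ => a n * x ^ n.1 * y ^ n.2) (Q x y)) :
    IsFlattoHahnSolution p q r Q ↔ IsBalanced (p : ℂ) q r a := by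
  have hs := summable_of_hasSum_pow_mul_pow ha
  constructor
  · intro hQ
    have hz : (fun n => inflow (p : ℂ) q r a n - a n) = 0 := by
      apply eq_zero_of_hasSum_pow_mul_pow_eq_zero
      · exact (hasSum_inflow _ _ _ hs.hasSum).summable.sub hs
      · intro x y hx0 hy0 hx hy
        have := hasSum_inflow_sub_self (p := p) (q := q) (r := r) ha hx hy hx0 hy0
        rwa [hQ.equation x y hx hy hx0 hy0, sub_self] at this
    exact fun n => sub_eq_zero.1 (congrFun hz n)
  · intro hb
    refine ⟨⟨a, ha⟩, fun x y hx hy hx0 hy0 => ?_⟩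
    have := hasSum_inflow_sub_self (p := p) (q := q) (r := r) ha hx hy hx0 hy0
    simp only [hb _, sub_self, zero_mul] at this
    exact (sub_eq_zero.1 (this.unique hasSum_zero)).symm

theorem IsFlattoHahnSolution.eq_of_apply_zero_zero_eq {p q r : ℝ} (hp : 0 < p) (hq : 0 < q)
    (hr : 0 ≤ r) (hpqr : p + q + r = 1) {Q Q' : ℂ → ℂ → ℂ} (hQ : IsFlattoHahnSolution p q r Q)
    (hQ' : IsFlattoHahnSolution p q r Q') (h0 : Q' 0 0 = Q 0 0) {x y : ℂ} (hx : ‖x‖ ≤ 1)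
    (hy : ‖y‖ ≤ 1) : Q' x y = Q x y := by
  obtain ⟨a, ha⟩ := hQ.expansion
  obtain ⟨b, hb⟩ := hQ'.expansion
  have e : ∀ {R : ℂ → ℂ → ℂ} {c : ℕ × ℕ → ℂ}, (∀ x y : ℂ, ‖x‖ ≤ 1 → ‖y‖ ≤ 1 →
      HasSum (fun n : ℕ × ℕ => c n * x ^ n.1 * y ^ n.2) (R x y)) → c (0, 0) = R 0 0 := by
    intro R c hc
    have := (hc 0 0 (by simp) (by simp)).pow_mul_pow_zero_left
    refine HasSum.unique ?_ this
    refine (hasSum_ite_eq 0 (c (0, 0))).congr_fun fun j => ?_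
    by_cases h : j = 0 <;> simp [h]
  have hab := ((isFlattoHahnSolution_iff hb).1 hQ').eq_of_apply_zero_eq hp hq hr hpqr
    (summable_of_hasSum_pow_mul_pow hb) (summable_of_hasSum_pow_mul_pow ha)
    ((isFlattoHahnSolution_iff ha).1 hQ) (by rw [e ha, e hb, h0])
  subst hab
  exact (hb x y hx hy).unique (ha x y hx hy)

end PowerSeries

/-! ### Laurent coefficients on a circle. -/

section LaurentCoeff

open Complex Metric

/-- The coefficient of `z ^ n` of the Laurent series of `f` on the circle of radius `R`. -/
noncomputable def laurentCoeff (R : ℝ) (n : ℤ) (f : ℂ → ℂ) : ℂ :=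
  (2 * Real.pi : ℂ)⁻¹ * ∫ θ in (0 : ℝ)..2 * Real.pi,
    circleMap 0 R θ ^ (-n) * f (circleMap 0 R θ)

variable {R : ℝ} {f g : ℂ → ℂ} {n : ℤ}

theorem ContinuousOn.comp_circleMap (hR : 0 ≤ R) (hf : ContinuousOn f (sphere 0 R)) :
    Continuous fun θ => f (circleMap 0 R θ) :=
  hf.comp_continuous (continuous_circleMap 0 R) fun θ => circleMap_mem_sphere 0 hR θ

theorem continuous_circleMap_zpow (hR : R ≠ 0) (n : ℤ) :
    Continuous fun θ => circleMap 0 R θ ^ n :=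
  (continuous_circleMap 0 R).zpow₀ n fun _ => Or.inl (circleMap_ne_center hR)

theorem laurentCoeff_congr (hR : 0 ≤ R) (h : ∀ z, ‖z‖ = R → f z = g z) :
    laurentCoeff R n f = laurentCoeff R n g := by
  unfold laurentCoeff
  congr 2
  funext θ
  rw [h _ (by simpa using circleMap_mem_sphere 0 hR θ)]

theorem laurentCoeff_add (hR : R ≠ 0) (hf : Continuous fun θ => f (circleMap 0 R θ))
    (hg : Continuous fun θ => g (circleMap 0 R θ)) :
    laurentCoeff R n (fun z => f z + g z) = laurentCoeff R n f + laurentCoeff R n g := by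
  unfold laurentCoeff
  rw [← mul_add, ← intervalIntegral.integral_add]
  · simp only [mul_add]
  · exact ((continuous_circleMap_zpow hR _).mul hf).intervalIntegrable _ _
  · exact ((continuous_circleMap_zpow hR _).mul hg).intervalIntegrable _ _

theorem laurentCoeff_const_mul (c : ℂ) :
    laurentCoeff R n (fun z => c * f z) = c * laurentCoeff R n f := by
  unfold laurentCoeff
  simp only [mul_left_comm _ c, intervalIntegral.integral_const_mul]

theorem laurentCoeff_id_mul (hR : R ≠ 0) :
    laurentCoeff R n (fun z => z * f z) = laurentCoeff R (n - 1) f := by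
  unfold laurentCoeff
  congr 2
  funext θ
  rw [show -(n - 1) = -n + 1 by ring, zpow_add_one₀ (circleMap_ne_center hR), mul_assoc]

theorem laurentCoeff_inv_mul (hR : R ≠ 0) :
    laurentCoeff R n (fun z => z⁻¹ * f z) = laurentCoeff R (n + 1) f := by
  unfold laurentCoeff
  congr 2
  funext θ
  rw [show -(n + 1) = -n - 1 by ring, zpow_sub_one₀ (circleMap_ne_center hR), mul_assoc]

theorem laurentCoeff_eq_circleIntegral (hR : R ≠ 0) :
    laurentCoeff R n f = (2 * Real.pi * I : ℂ)⁻¹ * ∮ z in C(0, R), z ^ (-n - 1) * f z := by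
  unfold laurentCoeff circleIntegral
  have : ∀ θ, deriv (circleMap 0 R) θ • (circleMap 0 R θ ^ (-n - 1) * f (circleMap 0 R θ)) =
      I * (circleMap 0 R θ ^ (-n) * f (circleMap 0 R θ)) := by
    intro θ
    have h0 : circleMap 0 R θ ≠ 0 := circleMap_ne_center hR
    rw [deriv_circleMap, zpow_sub_one₀ h0, smul_eq_mul]
    field_simp
  simp only [this, intervalIntegral.integral_const_mul]
  have hI := I_ne_zero
  rw [mul_inv _ I, mul_assoc (2 * Real.pi : ℂ)⁻¹, inv_mul_cancel_left₀ hI]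

theorem laurentCoeff_one (hR : R ≠ 0) :
    laurentCoeff R n (fun _ => 1) = if n = 0 then 1 else 0 := by
  rw [laurentCoeff_eq_circleIntegral hR]
  split_ifs with h
  · subst h
    have := circleIntegral.integral_sub_center_inv 0 hR
    simp only [sub_zero] at this
    simp only [neg_zero, zero_sub, zpow_neg_one, mul_one, this]
    exact inv_mul_cancel₀ two_pi_I_ne_zero
  · have := circleIntegral.integral_sub_zpow_of_ne (n := -n - 1) (by omega) 0 0 R
    simp only [sub_zero] at this
    simp only [mul_one, this, mul_zero]

theorem laurentCoeff_eq_zero (hR : 0 < R) (hf : DifferentiableOn ℂ f (closedBall 0 R))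
    (hn : n < 0) : laurentCoeff R n f = 0 := by
  rw [laurentCoeff_eq_circleIntegral hR.ne']
  obtain ⟨m, hm⟩ : ∃ m : ℕ, -n - 1 = m := ⟨(-n - 1).toNat, by omega⟩
  simp only [hm, zpow_natCast]
  have : DifferentiableOn ℂ (fun z => z ^ m * f z) (closedBall 0 R) := by fun_prop
  rw [(this.mono closure_ball_subset_closedBall).diffContOnCl.circleIntegral_eq_zero hR.le,
    mul_zero]

/-- This shape fits the functional equation in either variable: it is used first in `y` at fixed
`x`, then in `x` for the resulting coefficients. -/
theorem laurentCoeff_of_eq (hR : 0 < R) {c₀ c₁ c₂ k : ℂ → ℂ}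
    (h₀ : Continuous fun θ => c₀ (circleMap 0 R θ)) (h₁ : Continuous fun θ => c₁ (circleMap 0 R θ))
    (h₂ : Continuous fun θ => c₂ (circleMap 0 R θ)) (hk : Continuous fun θ => k (circleMap 0 R θ))
    (A B C D E E' : ℂ) (H : ∀ z, ‖z‖ = R → f z = A * (z⁻¹ * c₀ z) + (B * c₁ z +
      (C * (z * c₂ z) + (D * k z + (E * 1 + E' * (z⁻¹ * 1)))))) (n : ℤ) :
    laurentCoeff R n f = A * laurentCoeff R (n + 1) c₀ + (B * laurentCoeff R n c₁ +
      (C * laurentCoeff R (n - 1) c₂ + (D * laurentCoeff R n k +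
        (E * (if n = 0 then 1 else 0) + E' * (if n + 1 = 0 then 1 else 0))))) := by
  have hR0 := hR.ne'
  have hc := continuous_circleMap 0 R
  have hi : Continuous fun θ => (circleMap 0 R θ)⁻¹ := hc.inv₀ fun _ => circleMap_ne_center hR0
  have h1 : Continuous fun _ : ℝ => (1 : ℂ) := continuous_const
  have k₀ := (continuous_const (y := A)).mul (hi.mul h₀)
  have k₁ := (continuous_const (y := B)).mul h₁
  have k₂ := (continuous_const (y := C)).mul (hc.mul h₂)
  have k₃ := (continuous_const (y := D)).mul hk
  have k₄ := (continuous_const (y := E)).mul h1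
  have k₅ := (continuous_const (y := E')).mul (hi.mul h1)
  rw [laurentCoeff_congr hR.le H, laurentCoeff_add hR0, laurentCoeff_add hR0,
    laurentCoeff_add hR0, laurentCoeff_add hR0, laurentCoeff_add hR0, laurentCoeff_const_mul,
    laurentCoeff_const_mul, laurentCoeff_const_mul, laurentCoeff_const_mul,
    laurentCoeff_const_mul, laurentCoeff_const_mul, laurentCoeff_inv_mul hR0,
    laurentCoeff_inv_mul hR0, laurentCoeff_id_mul hR0, laurentCoeff_one hR0, laurentCoeff_one hR0]
  exacts [k₄, k₅, k₃, k₄.add k₅, k₂, k₃.add (k₄.add k₅), k₁, k₂.add (k₃.add (k₄.add k₅)), k₀,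
    k₁.add (k₂.add (k₃.add (k₄.add k₅)))]

theorem norm_laurentCoeff_le (hR : 0 < R) {M : ℝ} (hf : ∀ z, ‖z‖ = R → ‖f z‖ ≤ M) :
    ‖laurentCoeff R n f‖ ≤ R ^ (-n) * M := by
  unfold laurentCoeff
  have h : ∀ θ ∈ Set.uIoc 0 (2 * Real.pi),
      ‖circleMap 0 R θ ^ (-n) * f (circleMap 0 R θ)‖ ≤ R ^ (-n) * M := by
    intro θ _
    rw [norm_mul, norm_zpow, norm_circleMap_zero, abs_of_pos hR]
    gcongr
    exact hf _ (by simp [abs_of_pos hR])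
  have := intervalIntegral.norm_integral_le_of_norm_le_const h
  rw [norm_mul, norm_inv]
  have hpi : ‖(2 * Real.pi : ℂ)‖ = 2 * Real.pi := by
    simp [abs_of_pos Real.pi_pos]
  rw [hpi, inv_mul_le_iff₀ (by positivity)]
  rw [sub_zero, abs_of_pos (by positivity)] at this
  linarith

theorem hasSum_laurentCoeff (hR : 0 < R) (hf : DifferentiableOn ℂ f (closedBall 0 R)) {x : ℂ}
    (hx : ‖x‖ < R) : HasSum (fun n : ℕ => laurentCoeff R n f * x ^ n) (f x) := by
  lift R to NNReal using hR.le
  have h := (hf.hasFPowerSeriesOnBall (by exact_mod_cast hR)).hasSum (y := x) (by simpa using hx)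
  rw [zero_add] at h
  refine h.congr_fun fun n => ?_
  rw [laurentCoeff_eq_circleIntegral hR.ne']
  simp only [cauchyPowerSeries, ContinuousMultilinearMap.mkPiRing_apply, Fin.prod_const,
    sub_zero, smul_eq_mul]
  rw [mul_comm]
  congr 2
  refine circleIntegral.integral_congr hR.le fun z hz => ?_
  have h0 : z ≠ 0 := by
    rintro rfl
    simp at hz
    exact hR.ne hz
  rw [zpow_sub_one₀ h0, zpow_neg, zpow_natCast, inv_pow, mul_assoc]

theorem continuous_laurentCoeff (hR : R ≠ 0) {F : ℂ → ℂ → ℂ}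
    (hF : Continuous fun θ : ℝ × ℝ => F (circleMap 0 R θ.1) (circleMap 0 R θ.2)) :
    Continuous fun θ : ℝ => laurentCoeff R n (F (circleMap 0 R θ)) := by
  unfold laurentCoeff
  refine continuous_const.mul ?_
  apply intervalIntegral.continuous_parametric_intervalIntegral_of_continuous'
  exact ((continuous_circleMap_zpow hR _).comp continuous_snd).mul hF

theorem laurentCoeff_comm (hR : R ≠ 0) {F : ℂ → ℂ → ℂ} (m n : ℤ)
    (hF : Continuous fun θ : ℝ × ℝ => F (circleMap 0 R θ.1) (circleMap 0 R θ.2)) :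
    laurentCoeff R m (fun x => laurentCoeff R n (F x)) =
      laurentCoeff R n (fun y => laurentCoeff R m fun x => F x y) := by
  unfold laurentCoeff
  simp only [mul_left_comm _ (2 * Real.pi : ℂ)⁻¹, intervalIntegral.integral_const_mul]
  congr 2
  simp only [← intervalIntegral.integral_const_mul]
  rw [MeasureTheory.intervalIntegral_intervalIntegral_swap]
  · congr 1
    funext φ
    congr 1
    funext θ
    ring
  · have : Continuous fun θ : ℝ × ℝ => circleMap 0 R θ.1 ^ (-m) * (circleMap 0 R θ.2 ^ (-n) *
        F (circleMap 0 R θ.1) (circleMap 0 R θ.2)) :=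
      ((continuous_circleMap_zpow hR _).comp continuous_fst).mul
        (((continuous_circleMap_zpow hR _).comp continuous_snd).mul hF)
    refine (this.continuousOn.integrableOn_compact
      (isCompact_uIcc.prod isCompact_uIcc)).mono_set
      (Set.prod_mono Set.uIoc_subset_uIcc Set.uIoc_subset_uIcc)

/-- A quotient by a quadratic polynomial whose only possible zero in a disc is a zero of the
numerator has no Laurent coefficients of negative index. -/
theorem laurentCoeff_div_quadratic_eq_zero {R' : ℝ} (hR : 0 < R) (hRR' : R < R')
    (hf : DifferentiableOn ℂ f (ball 0 R')) {A B C : ℂ} (hAC : ‖A‖ * R ^ 2 < ‖C‖) (hA : A ≠ 0)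
    (h0 : ∀ y, ‖y‖ = R → A * y ^ 2 + B * y + C ≠ 0)
    (hroot : ∀ y, ‖y‖ ≤ R → A * y ^ 2 + B * y + C = 0 → f y = 0) (hn : n < 0) :
    laurentCoeff R n (fun y => f y / (A * y ^ 2 + B * y + C)) = 0 := by
  obtain ⟨s, hs⟩ := IsAlgClosed.exists_pow_nat_eq (B ^ 2 - 4 * A * C) (n := 2) two_pos
  obtain ⟨u, v, huv, hu⟩ : ∃ u v : ℂ, (∀ y, A * y ^ 2 + B * y + C = A * (y - u) * (y - v)) ∧
      R < ‖v‖ := by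
    have hfac : ∀ y, A * y ^ 2 + B * y + C =
        A * (y - (-B + s) / (2 * A)) * (y - (-B - s) / (2 * A)) := by
      intro y
      field_simp
      linear_combination hs
    have hprod : A * ((-B + s) / (2 * A)) * ((-B - s) / (2 * A)) = C := by
      have := hfac 0
      linear_combination -this
    -- The roots have product `C / A`, of modulus above `R ^ 2`, so at least one lies outside the
    -- disc; it is named `v`.
    by_cases h : R < ‖(-B - s) / (2 * A)‖
    · exact ⟨_, _, hfac, h⟩
    · refine ⟨(-B - s) / (2 * A), (-B + s) / (2 * A), fun y => ?_, ?_⟩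
      · rw [hfac y]
        ring
      · by_contra h'
        rw [← hprod, norm_mul, norm_mul] at hAC
        have : ‖(-B + s) / (2 * A)‖ * ‖(-B - s) / (2 * A)‖ ≤ R * R :=
          mul_le_mul (not_lt.1 h') (not_lt.1 h) (norm_nonneg _) hR.le
        have := mul_le_mul_of_nonneg_left this (norm_nonneg A)
        linarith [mul_assoc ‖A‖ ‖(-B + s) / (2 * A)‖ ‖(-B - s) / (2 * A)‖, sq R]
  have hv : ∀ y ∈ closedBall (0 : ℂ) R, y - v ≠ 0 := by
    intro y hy h
    rw [sub_eq_zero.1 h] at hy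
    exact hu.not_ge (by simpa using hy)
  have hsub : closedBall (0 : ℂ) R ⊆ ball 0 R' := closedBall_subset_ball hRR'
  by_cases hu' : ‖u‖ ≤ R
  · have hfu : f u = 0 := hroot u hu' (by rw [huv]; ring)
    -- Since `f u = 0`, the factor `y - u` cancels, and `dslope` supplies the holomorphic extension
    -- across `u`.
    have hG : DifferentiableOn ℂ (fun y => dslope f u y / (A * (y - v))) (closedBall 0 R) := by
      have h1 : DifferentiableOn ℂ (dslope f u) (closedBall 0 R) := by
        refine ((differentiableOn_dslope ?_).2 hf).mono hsub
        exact isOpen_ball.mem_nhds (hsub (by simpa using hu'))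
      refine h1.div (by fun_prop) fun y hy => mul_ne_zero hA (hv y hy)
    rw [← laurentCoeff_eq_zero hR hG hn]
    refine laurentCoeff_congr hR.le fun y hy => ?_
    have hyu : y - u ≠ 0 := by
      intro h
      apply h0 y hy
      rw [huv, h]
      ring
    have hyv := hv y (by simp [hy])
    have := sub_smul_dslope f u y
    rw [hfu, sub_zero, smul_eq_mul] at this
    rw [huv, ← this]
    field_simp
  · apply laurentCoeff_eq_zero hR _ hn
    refine (hf.mono hsub).div (by fun_prop) fun y hy => ?_
    rw [huv]
    refine mul_ne_zero (mul_ne_zero hA fun h => hu' ?_) (hv y hy)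
    rw [← sub_eq_zero.1 h]
    simpa using hy

end LaurentCoeff

/-! ### Dividing by the kernel on a torus of radius above one. -/

section KernelQuotient

open Complex Metric

/-- The series `Q` obtained by solving the functional equation with `Q(x, 0) = h x` and
`Q(0, y) = g y`. -/
noncomputable def kernelQuotient (p q r : ℝ) (h g : ℂ → ℂ) (x y : ℂ) : ℂ :=
  (q * x * (y - 1) * h x + p * y * (x - 1) * g y) / (-r * x ^ 2 * y ^ 2 + (x - p) * y + -q * x)

theorem kernelQuotient_swap (p q r : ℝ) (h g : ℂ → ℂ) (x y : ℂ) :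
    kernelQuotient p q r h g x y = kernelQuotient q p r g h y x := by
  unfold kernelQuotient
  congr 1 <;> ring

variable {p q r R R' : ℝ} {h g : ℂ → ℂ}

/-- A zero would give `p / x + q / y + r x y = 1`, but `hS` bounds the modulus of the left side
below `1`. -/
theorem kernel_ne_zero (hp : 0 < p) (hq : 0 < q) (hr : 0 < r) (hR : 0 < R)
    (hS : p / R + q / R + r * R ^ 2 < 1) {x y : ℂ} (hx : ‖x‖ = R) (hy : ‖y‖ = R) :
    -r * x ^ 2 * y ^ 2 + (x - p) * y + -q * x ≠ 0 := by
  intro h0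
  have hx0 : x ≠ 0 := norm_pos_iff.1 (hx ▸ hR)
  have hy0 : y ≠ 0 := norm_pos_iff.1 (hy ▸ hR)
  have h1 : p / x + q / y + r * x * y = 1 := by
    field_simp
    linear_combination -h0
  have h2 := norm_add₃_le (a := (p / x : ℂ)) (b := q / y) (c := r * x * y)
  rw [h1, norm_div, norm_div, norm_mul, norm_mul, hx, hy, Complex.norm_of_nonneg hp.le,
    Complex.norm_of_nonneg hq.le, Complex.norm_of_nonneg hr.le, norm_one] at h2
  linarith [sq R, mul_assoc r R R]

theorem continuous_kernelQuotient (hp : 0 < p) (hq : 0 < q) (hr : 0 < r) (hR : 0 < R)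
    (hS : p / R + q / R + r * R ^ 2 < 1) (hh : ContinuousOn h (sphere 0 R))
    (hg : ContinuousOn g (sphere 0 R)) : ContinuousOn
      (fun z : ℂ × ℂ => kernelQuotient p q r h g z.1 z.2) (sphere 0 R ×ˢ sphere 0 R) := by
  unfold kernelQuotient
  have hh' : ContinuousOn (fun z : ℂ × ℂ => h z.1) (sphere 0 R ×ˢ sphere 0 R) :=
    hh.comp continuousOn_fst fun z hz => hz.1
  have hg' : ContinuousOn (fun z : ℂ × ℂ => g z.2) (sphere 0 R ×ˢ sphere 0 R) :=
    hg.comp continuousOn_snd fun z hz => hz.2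
  have h1 : ContinuousOn (fun z : ℂ × ℂ => (q : ℂ) * z.1 * (z.2 - 1))
    (sphere 0 R ×ˢ sphere 0 R) := by fun_prop
  have h2 : ContinuousOn (fun z : ℂ × ℂ => (p : ℂ) * z.2 * (z.1 - 1))
    (sphere 0 R ×ˢ sphere 0 R) := by fun_prop
  refine ((h1.mul hh').add (h2.mul hg')).div (by fun_prop) fun z hz => ?_
  exact kernel_ne_zero hp hq hr hR hS (by simpa using hz.1) (by simpa using hz.2)

theorem continuous_kernelQuotient_comp (hp : 0 < p) (hq : 0 < q) (hr : 0 < r) (hR : 0 < R)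
    (hS : p / R + q / R + r * R ^ 2 < 1) (hh : ContinuousOn h (sphere 0 R))
    (hg : ContinuousOn g (sphere 0 R)) {γ : ℝ → ℂ} (hγ : Continuous γ) (hγR : ∀ θ, ‖γ θ‖ = R) :
    Continuous fun θ : ℝ × ℝ => kernelQuotient p q r h g (γ θ.1) (γ θ.2) := by
  have hm : ∀ θ, γ θ ∈ sphere (0 : ℂ) R := fun θ => by simpa using hγR θ
  have h1 : Continuous fun θ : ℝ × ℝ => h (γ θ.1) :=
    (hh.comp_continuous hγ hm).comp continuous_fst
  have h2 : Continuous fun θ : ℝ × ℝ => g (γ θ.2) :=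
    (hg.comp_continuous hγ hm).comp continuous_snd
  have h3 : Continuous fun θ : ℝ × ℝ => (q : ℂ) * γ θ.1 * (γ θ.2 - 1) := by fun_prop
  have h4 : Continuous fun θ : ℝ × ℝ => (p : ℂ) * γ θ.2 * (γ θ.1 - 1) := by fun_prop
  exact ((h3.mul h1).add (h4.mul h2)).div (by fun_prop) fun θ =>
    kernel_ne_zero hp hq hr hR hS (hγR _) (hγR _)

theorem kernelQuotient_eq (hp : 0 < p) (hq : 0 < q) (hr : 0 < r) (hR : 0 < R)
    (hS : p / R + q / R + r * R ^ 2 < 1) {x y : ℂ} (hx : ‖x‖ = R) (hy : ‖y‖ = R) :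
    kernelQuotient p q r h g x y = q * (y⁻¹ * kernelQuotient p q r h g x y) +
      (p * x⁻¹ * kernelQuotient p q r h g x y + (r * x * (y * kernelQuotient p q r h g x y) +
        (p * (1 - x⁻¹) * g y + (q * h x * 1 + -q * h x * (y⁻¹ * 1))))) := by
  have hx0 : x ≠ 0 := norm_pos_iff.1 (hx ▸ hR)
  have hy0 : y ≠ 0 := norm_pos_iff.1 (hy ▸ hR)
  have hK := kernel_ne_zero hp hq hr hR hS hx hy
  have h1 := div_mul_cancel₀ (q * x * (y - 1) * h x + p * y * (x - 1) * g y) hK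
  rw [← kernelQuotient] at h1
  generalize kernelQuotient p q r h g x y = F at h1 ⊢
  field_simp
  linear_combination h1

/-- As a quadratic in `y` the kernel has leading coefficient `-r x²` and constant term `-q x`; `hrq`
makes the product of its roots larger than `R ^ 2` in modulus, and `hN` cancels any root inside. -/
theorem laurentCoeff_kernelQuotient_eq_zero (hr : 0 < r) (hp : 0 < p) (hq : 0 < q)
    (hR : 1 < R) (hRR' : R < R') (hS : p / R + q / R + r * R ^ 2 < 1) (hrq : r * R ^ 3 < q)
    (hg : DifferentiableOn ℂ g (ball 0 R'))
    (hN : ∀ x y : ℂ, ‖x‖ ≤ R → ‖y‖ ≤ R → -r * x ^ 2 * y ^ 2 + (x - p) * y + -q * x = 0 →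
      q * x * (y - 1) * h x + p * y * (x - 1) * g y = 0) {x : ℂ} (hx : ‖x‖ = R) {n : ℤ}
    (hn : n < 0) : laurentCoeff R n (kernelQuotient p q r h g x) = 0 := by
  have hR0 : 0 < R := by linarith
  have hx0 : x ≠ 0 := norm_pos_iff.1 (hx ▸ hR0)
  apply laurentCoeff_div_quadratic_eq_zero hR0 hRR' (by fun_prop) _ _ _ _ hn
  · rw [norm_mul, norm_neg, norm_pow, norm_mul, norm_neg, Complex.norm_of_nonneg hr.le,
      Complex.norm_of_nonneg hq.le, hx]
    have := mul_lt_mul_of_pos_right hrq hR0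
    linarith [show r * R ^ 3 * R = r * R ^ 2 * R ^ 2 by ring]
  · have : (r : ℂ) ≠ 0 := by exact_mod_cast hr.ne'
    exact mul_ne_zero (neg_ne_zero.2 this) (pow_ne_zero _ hx0)
  · intro y hy
    exact kernel_ne_zero hp hq hr hR0 hS hx hy
  · intro y hy h0
    exact hN x y hx.le hy h0

theorem laurentCoeff_kernelQuotient (hr : 0 < r) (hp : 0 < p) (hq : 0 < q)
    (hR : 0 < R) (hS : p / R + q / R + r * R ^ 2 < 1) (hh : ContinuousOn h (sphere 0 R))
    (hg : ContinuousOn g (sphere 0 R)) {x : ℂ} (hx : ‖x‖ = R) (n : ℤ) :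
    laurentCoeff R n (kernelQuotient p q r h g x) =
      q * laurentCoeff R (n + 1) (kernelQuotient p q r h g x) +
      (p * x⁻¹ * laurentCoeff R n (kernelQuotient p q r h g x) +
        (r * x * laurentCoeff R (n - 1) (kernelQuotient p q r h g x) +
      (p * (1 - x⁻¹) * laurentCoeff R n g + (q * h x * (if n = 0 then 1 else 0) +
        -q * h x * (if n + 1 = 0 then 1 else 0))))) := by
  have hF : ContinuousOn (kernelQuotient p q r h g x) (sphere 0 R) :=
    (continuous_kernelQuotient hp hq hr hR hS hh hg).comp (f := fun y : ℂ => (x, y))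
      (by fun_prop) fun y hy => ⟨by simpa using hx, hy⟩
  have hF' := hF.comp_circleMap hR.le
  exact laurentCoeff_of_eq hR hF' hF' hF' (hg.comp_circleMap hR.le) _ _ _ _ _ _
    (fun y hy => kernelQuotient_eq hp hq hr hR hS hx hy) n

/-- In the functional equation at index `-1` all terms of negative index drop out, leaving `q` times
coefficient `0` against `q * h x`. -/
theorem laurentCoeff_zero_kernelQuotient (hr : 0 < r) (hp : 0 < p) (hq : 0 < q)
    (hR : 1 < R) (hRR' : R < R') (hS : p / R + q / R + r * R ^ 2 < 1) (hrq : r * R ^ 3 < q)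
    (hh : DifferentiableOn ℂ h (ball 0 R')) (hg : DifferentiableOn ℂ g (ball 0 R'))
    (hN : ∀ x y : ℂ, ‖x‖ ≤ R → ‖y‖ ≤ R → -r * x ^ 2 * y ^ 2 + (x - p) * y + -q * x = 0 →
      q * x * (y - 1) * h x + p * y * (x - 1) * g y = 0) {x : ℂ} (hx : ‖x‖ = R) :
    laurentCoeff R 0 (kernelQuotient p q r h g x) = h x := by
  have hR0 : 0 < R := by linarith
  have hsub : closedBall (0 : ℂ) R ⊆ ball 0 R' := closedBall_subset_ball hRR'
  have hz := fun {n : ℤ} => laurentCoeff_kernelQuotient_eq_zero (n := n) hr hp hq hR hRR' hS hrq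
    hg hN hx
  have := laurentCoeff_kernelQuotient hr hp hq hR0 hS
    (hh.continuousOn.mono (sphere_subset_closedBall.trans hsub))
    (hg.continuousOn.mono (sphere_subset_closedBall.trans hsub)) hx (-1)
  rw [hz (n := -1) (by norm_num), hz (n := -1 - 1) (by norm_num),
    laurentCoeff_eq_zero hR0 (hg.mono hsub) (by norm_num)] at this
  have hq0 : (q : ℂ) ≠ 0 := by exact_mod_cast hq.ne'
  apply mul_left_cancel₀ hq0
  norm_num at this
  linear_combination -this

/-- If the numerator `q x (y - 1) h(x) + p y (x - 1) g(y)` vanishes with the kernel in a bidisc of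
radius larger than `1`, the functional equation has a solution with `Q(x, 0) = h x` and
`Q(0, y) = g y`. -/
theorem exists_isBalanced_of_kernel (hr : 0 < r) (hp : 0 < p) (hq : 0 < q)
    (hR : 1 < R) (hRR' : R < R') (hS : p / R + q / R + r * R ^ 2 < 1) (hrp : r * R ^ 3 < p)
    (hrq : r * R ^ 3 < q) (hh : DifferentiableOn ℂ h (ball 0 R'))
    (hg : DifferentiableOn ℂ g (ball 0 R'))
    (hN : ∀ x y : ℂ, ‖x‖ ≤ R → ‖y‖ ≤ R → -r * x ^ 2 * y ^ 2 + (x - p) * y + -q * x = 0 →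
      q * x * (y - 1) * h x + p * y * (x - 1) * g y = 0) :
    ∃ a : ℕ × ℕ → ℂ, Summable a ∧ IsBalanced (p : ℂ) q r a ∧
      (∀ x : ℂ, ‖x‖ ≤ 1 → HasSum (fun i => a (i, 0) * x ^ i) (h x)) ∧
      ∀ y : ℂ, ‖y‖ ≤ 1 → HasSum (fun j => a (0, j) * y ^ j) (g y) := by
  have hR0 : 0 < R := by linarith
  have hsub : closedBall (0 : ℂ) R ⊆ ball 0 R' := closedBall_subset_ball hRR'
  have hhs := hh.continuousOn.mono (sphere_subset_closedBall.trans hsub)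
  have hgs := hg.continuousOn.mono (sphere_subset_closedBall.trans hsub)
  have hS' : q / R + p / R + r * R ^ 2 < 1 := by linarith
  have hN' : ∀ x y : ℂ, ‖x‖ ≤ R → ‖y‖ ≤ R → -r * x ^ 2 * y ^ 2 + (x - q) * y + -p * x = 0 →
      p * x * (y - 1) * g x + q * y * (x - 1) * h y = 0 := by
    intro x y hx hy h0
    rw [add_comm]
    exact hN y x hy hx (by linear_combination h0)
  let F := kernelQuotient p q r h g
  let A : ℤ → ℤ → ℂ := fun i j => laurentCoeff R i fun x => laurentCoeff R j (F x)
  have hFs := continuous_kernelQuotient hp hq hr hR0 hS hhs hgs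
  have hFc : Continuous fun θ : ℝ × ℝ => F (circleMap 0 R θ.1) (circleMap 0 R θ.2) :=
    continuous_kernelQuotient_comp hp hq hr hR0 hS hhs hgs (continuous_circleMap 0 R) fun θ => by
      rw [norm_circleMap_zero, abs_of_pos hR0]
  -- Exchanging the two integrals lets the one-variable results in `y` be reused in `x`, with `p`
  -- and `q` interchanged.
  have hA : ∀ i j, A i j = laurentCoeff R j fun y =>
      laurentCoeff R i (kernelQuotient q p r g h y) := by
    intro i j
    have e : ∀ y, (fun x => F x y) = kernelQuotient q p r g h y := fun y =>
      funext fun x => kernelQuotient_swap p q r h g x y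
    rw [← funext fun y => congrArg (laurentCoeff R i) (e y)]
    exact laurentCoeff_comm hR0.ne' i j hFc
  have hzero : ∀ n : ℤ, laurentCoeff R n (fun _ => 0) = 0 := by
    intro n
    simp [laurentCoeff]
  have hAj : ∀ i j, j < 0 → A i j = 0 := by
    intro i j hj
    rw [← hzero i]
    exact laurentCoeff_congr hR0.le fun x hx =>
      laurentCoeff_kernelQuotient_eq_zero hr hp hq hR hRR' hS hrq hg hN hx hj
  have hAi : ∀ i j, i < 0 → A i j = 0 := by
    intro i j hi
    rw [hA, ← hzero j]
    exact laurentCoeff_congr hR0.le fun y hy =>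
      laurentCoeff_kernelQuotient_eq_zero hr hq hp hR hRR' hS' hrp hh hN' hy hi
  have hA0 : ∀ i, A i 0 = laurentCoeff R i h := fun i =>
    laurentCoeff_congr hR0.le fun x hx =>
      laurentCoeff_zero_kernelQuotient hr hp hq hR hRR' hS hrq hh hg hN hx
  have h0A : ∀ j, A 0 j = laurentCoeff R j g := fun j =>
    (hA 0 j).trans <| laurentCoeff_congr hR0.le fun y hy =>
      laurentCoeff_zero_kernelQuotient hr hq hp hR hRR' hS' hrp hg hh hN' hy
  have hbal : ∀ i j, A i j = p * A (i + 1) j + (q * A i (j + 1) + (r * A (i - 1) (j - 1) +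
      (q * ((if j = 0 then 1 else 0) - if j + 1 = 0 then 1 else 0) * A i 0 +
        (p * A 0 j * (if i = 0 then 1 else 0) + -(p * A 0 j) * if i + 1 = 0 then 1 else 0)))) := by
    intro i j
    have hc : ∀ n, Continuous fun θ => laurentCoeff R n (F (circleMap 0 R θ)) := fun n =>
      continuous_laurentCoeff hR0.ne' hFc
    rw [hA0, h0A]
    refine laurentCoeff_of_eq hR0 (hc j) (hc (j + 1)) (hc (j - 1)) (hhs.comp_circleMap hR0.le)
      _ _ _ _ _ _ (fun x hx => ?_) i
    refine (laurentCoeff_kernelQuotient hr hp hq hR0 hS hhs hgs hx j).trans ?_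
    ring
  obtain ⟨M, hM⟩ := ((isCompact_sphere (0 : ℂ) R).prod
    (isCompact_sphere (0 : ℂ) R)).exists_bound_of_continuousOn hFs
  -- Cauchy's estimate in each variable; `R > 1` turns it into absolute summability on the closed
  -- unit bidisc.
  have hbound : ∀ i j : ℕ, ‖A i j‖ ≤ M * (R⁻¹ ^ i * R⁻¹ ^ j) := by
    intro i j
    have := norm_laurentCoeff_le (n := i) hR0 (f := fun x => laurentCoeff R j (F x))
      (M := R ^ (-j : ℤ) * M) fun x hx => norm_laurentCoeff_le hR0 fun y hy =>
        hM (x, y) ⟨by simpa using hx, by simpa using hy⟩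
    refine this.trans_eq ?_
    rw [zpow_neg, zpow_neg, zpow_natCast, zpow_natCast, inv_pow, inv_pow]
    ring
  refine ⟨fun n => A n.1 n.2, ?_, ?_, ?_, ?_⟩
  · have hg := summable_geometric_of_lt_one (inv_nonneg.2 hR0.le) (inv_lt_one_of_one_lt₀ hR)
    refine Summable.of_norm_bounded ((hg.mul_of_nonneg hg (fun _ => by positivity)
      fun _ => by positivity).mul_left M) fun n => hbound n.1 n.2
  · rintro ⟨i, j⟩
    have hd : diagShift (fun n : ℕ × ℕ => A n.1 n.2) (i, j) = A (i - 1) (j - 1) := by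
      rcases i with _ | i
      · rw [hAi _ _ (by simp)]
        rfl
      · rcases j with _ | j
        · rw [hAj _ _ (by simp)]
          rfl
        · simp [diagShift]
    have := hbal i j
    rw [if_neg (by omega : ¬ (j : ℤ) + 1 = 0), if_neg (by omega : ¬ (i : ℤ) + 1 = 0)] at this
    simp only [inflow, hd, Nat.cast_add, Nat.cast_one]
    simp only [Nat.cast_eq_zero] at this
    rcases eq_or_ne i 0 with rfl | hi <;> rcases eq_or_ne j 0 with rfl | hj <;>
      simp only [*, if_true, if_false] at this ⊢ <;>
      linear_combination -this
  · intro x hx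
    refine (hasSum_laurentCoeff hR0 (hh.mono hsub) (hx.trans_lt hR)).congr_fun fun i => ?_
    simp [hA0]
  · intro y hy
    refine (hasSum_laurentCoeff hR0 (hg.mono hsub) (hy.trans_lt hR)).congr_fun fun j => ?_
    simp [h0A]

end KernelQuotient

/-! ### Bounds on the smallest root of the cubic. -/

section CubicRoot

theorem exists_cubic_root_le {p q r v : ℝ} (hv : 0 < v) (h : 2 + p * q * r * v ^ 3 ≤ v) :
    ∃ z ∈ {z : ℝ | 0 < z ∧ z = 2 + p * q * r * z ^ 3}, z ≤ v := by
  have hc : ContinuousOn (fun z : ℝ => z - (2 + p * q * r * z ^ 3)) (Set.Icc 0 v) := by fun_prop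
  obtain ⟨z, hz, hz0⟩ := intermediate_value_Icc hv.le hc
    (show (0 : ℝ) ∈ Set.Icc _ _ from ⟨by norm_num, by simpa using h⟩)
  refine ⟨z, ⟨lt_of_le_of_ne hz.1 ?_, sub_eq_zero.1 hz0⟩, hz.2⟩
  rintro rfl
  norm_num at hz0

variable {p q r w : ℝ} (hp : 0 < p) (hq : 0 < q) (hr : 0 < r) (hpqr : p + q + r = 1)

-- This is the arithmetic-geometric mean bound `p q r ≤ 1 / 27`; it places a root in `(0, 3]`.
include hp hq hr hpqr in
theorem cubic_three_le : 2 + p * q * r * 3 ^ 3 ≤ 3 := by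
  have : p * q * r ≤ 1 / 27 := by
    have hr' : r = 1 - p - q := by linarith
    subst hr'
    nlinarith [sq_nonneg (p - q), sq_nonneg (p - (1 - p - q)), sq_nonneg (q - (1 - p - q)),
      mul_nonneg hp.le (sq_nonneg (q - (1 - p - q))), mul_nonneg hq.le (sq_nonneg (p - (1 - p - q))),
      mul_nonneg hr.le (sq_nonneg (p - q))]
  linarith

include hp hq hr hpqr in
theorem exists_isLeast_cubic_root : ∃ w, IsLeast {z : ℝ | 0 < z ∧ z = 2 + p * q * r * z ^ 3} w := by
  obtain ⟨z₀, hz₀, hz₀3⟩ := exists_cubic_root_le three_pos (cubic_three_le hp hq hr hpqr)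
  have hclosed : IsClosed {z : ℝ | z = 2 + p * q * r * z ^ 3} :=
    isClosed_eq continuous_id (by fun_prop)
  obtain ⟨w, hw⟩ := ((isCompact_Icc (a := (0 : ℝ)) (b := 3)).inter_right hclosed).exists_isLeast
    ⟨z₀, ⟨hz₀.1.le, hz₀3⟩, hz₀.2⟩
  refine ⟨w, ⟨lt_of_le_of_ne hw.1.1.1 ?_, hw.1.2⟩, fun z hz => ?_⟩
  · rintro rfl
    have := hw.1.2
    norm_num at this
  · by_cases h : z ≤ 3
    · exact hw.2 ⟨⟨hz.1.le, h⟩, hz.2⟩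
    · exact hw.1.1.2.trans (not_le.1 h).le

variable (hw : IsLeast {z : ℝ | 0 < z ∧ z = 2 + p * q * r * z ^ 3} w)

include hw in
theorem cubic_root_lt {v : ℝ} (hv : 0 < v) (h : 2 + p * q * r * v ^ 3 < v) : w < v := by
  obtain ⟨z, hz, hzv⟩ := exists_cubic_root_le hv h.le
  refine (hw.2 hz).trans_lt (lt_of_le_of_ne hzv ?_)
  rintro rfl
  exact h.ne hz.2.symm

include hp hq hr hpqr hw

theorem cubic_root_le_three : w ≤ 3 := by
  obtain ⟨z, hz, hz3⟩ := exists_cubic_root_le three_pos (cubic_three_le hp hq hr hpqr)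
  exact (hw.2 hz).trans hz3

theorem cubic_lt_of_cubic_root_lt {z : ℝ} (hwz : w < z) (hz : z < 3) :
    2 + p * q * r * z ^ 3 < z := by
  have h3 := cubic_three_le hp hq hr hpqr
  have hwe := hw.1.2
  have hw0 : 0 < w := hw.1.1
  have hk : 0 < p * q * r := by positivity
  generalize p * q * r = k at *
  -- Subtracting the equation at `w` from the inequality at `3` leaves `3 - w > 0` times `1 - k (9 +
  -- 3w + w²)`.
  have h1 : k * (9 + 3 * w + w ^ 2) ≤ 1 := by
    by_contra h
    nlinarith [mul_pos (sub_pos.2 (hwz.trans hz)) (sub_pos.2 (not_le.1 h))]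
  have h2 : k * (z ^ 2 + z * w + w ^ 2) < 1 := by
    refine lt_of_lt_of_le ?_ h1
    apply mul_lt_mul_of_pos_left _ hk
    nlinarith
  nlinarith [mul_pos (sub_pos.2 hwz) (sub_pos.2 h2)]

/-- Testing the cubic at `2 / (p + q)` leaves a positive multiple of `(p - q) ^ 2`, so the smallest
root lies strictly below that point. -/
theorem add_mul_cubic_root_lt_two (hne : p ≠ q) : (p + q) * w < 2 := by
  have hpq : 0 < p + q := by positivity
  rw [mul_comm, ← lt_div_iff₀ hpq]
  apply cubic_root_lt hw (by positivity)
  have hr' : r = 1 - p - q := by linarith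
  rw [div_pow, lt_div_iff₀ hpq, hr', ← sub_pos]
  have : 2 - (2 + p * q * (1 - p - q) * (2 ^ 3 / (p + q) ^ 3)) * (p + q) =
      2 * (1 - p - q) * (p - q) ^ 2 / (p + q) ^ 2 := by
    field_simp
    ring
  rw [this]
  have h1 : 0 < 1 - p - q := hr' ▸ hr
  have h2 : 0 < (p - q) ^ 2 := sq_pos_of_ne_zero (sub_ne_zero.2 hne)
  positivity

theorem mul_mul_cubic_root_sq_lt_one (hne : p ≠ q) : p * q * w ^ 2 < 1 := by
  have h := add_mul_cubic_root_lt_two hp hq hr hpqr hw hne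
  have hw0 : 0 < w := hw.1.1
  have h1 : r * w * (p * q * w ^ 2) = w - 2 := by linear_combination -hw.1.2
  have h2 : r * w * (p * q * w ^ 2) < r * w * 1 := by
    rw [h1]
    have : (p + q + r) * w = w := by rw [hpqr, one_mul]
    linarith
  exact lt_of_mul_lt_mul_left h2 (by positivity)

theorem mul_cubic_root_lt_one (hrp : r < p) (hrq : r < q) : r * w < 1 := by
  have h := cubic_root_le_three hp hq hr hpqr hw
  nlinarith

theorem cubic_root_eq (hrp : r < p) (hpq : p = q) : w = 1 / p := by
  subst hpq
  have h1 : 1 / p = 2 + p * p * r * (1 / p) ^ 3 := by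
    have hr' : r = 1 - p - p := by linarith
    rw [hr']
    field_simp
    ring
  -- Since `p > r`, the root `1 / p` is below `3`; a smaller root would force strict inequality in
  -- the cubic at `1 / p`.
  refine (hw.2 ⟨by positivity, h1⟩).eq_of_not_lt fun hlt => ?_
  have := cubic_lt_of_cubic_root_lt hp hq hr hpqr hw hlt (by
    rw [div_lt_iff₀ hp]
    linarith)
  linarith

end CubicRoot

/-! ### The axis functions and the vanishing of the numerator on the kernel. -/

section AxisSeries

open Complex Metric

theorem Complex.sqrt_sq (z : ℂ) : Complex.sqrt z ^ 2 = z := by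
  rw [Complex.sqrt, ← cpow_nat_mul]
  norm_num

theorem Complex.sqrt_re_pos {z : ℂ} (hz : 0 < z.re) : 0 < (Complex.sqrt z).re := by
  rw [Complex.sqrt, cpow_inv_two_re]
  have := norm_nonneg z
  positivity

/-- Principal roots of points in the right half-plane satisfy `|im| < re`, so a product of two stays
in the right half-plane. This fixes a sign in `numerator_eq_zero`. -/
theorem Complex.sqrt_mul_sqrt_re_pos {z v : ℂ} (hz : 0 < z.re) (hv : 0 < v.re) :
    0 < (Complex.sqrt z * Complex.sqrt v).re := by
  have key : ∀ {z : ℂ}, 0 < z.re → |(Complex.sqrt z).im| < (Complex.sqrt z).re := by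
    intro z hz
    apply abs_lt_of_sq_lt_sq _ (Complex.sqrt_re_pos hz).le
    have := congrArg re (Complex.sqrt_sq z)
    rw [sq, mul_re] at this
    nlinarith
  have h1 := key hz
  have h2 := key hv
  rw [mul_re]
  have h3 := mul_lt_mul'' h1 h2 (abs_nonneg _) (abs_nonneg _)
  rw [← abs_mul] at h3
  linarith [le_abs_self ((Complex.sqrt z).im * (Complex.sqrt v).im)]

theorem Complex.sqrt_ofReal {x : ℝ} (hx : 0 ≤ x) : Complex.sqrt (x : ℂ) = (√x : ℝ) := by
  rw [Complex.sqrt_of_nonneg (by exact_mod_cast hx), ofReal_re]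

theorem Complex.re_one_sub_pos {z : ℂ} (hz : ‖z‖ < 1) : 0 < (1 - z).re := by
  rw [sub_re, one_re]
  linarith [re_le_norm z]

/-- The value on the `x`-axis of the solution of the functional equation with constant term `c`. -/
noncomputable def axisSeries (c p q r w : ℝ) (x : ℂ) : ℂ :=
  c * p * (1 + Complex.sqrt (1 - x * q * r * w ^ 2) * √(1 - p * r * w ^ 2) - r * w * x) /
    ((p - r * x) * (Complex.sqrt (1 - x * q * r * w ^ 2) + √(1 - p * r * w ^ 2)))

variable {c p q r w : ℝ} {x : ℂ}

theorem norm_mul_mul_mul_sq (hq : 0 ≤ q) (hr : 0 ≤ r) (x : ℂ) :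
    ‖x * q * r * w ^ 2‖ = ‖x‖ * (q * r * w ^ 2) := by
  rw [norm_mul, norm_mul, norm_mul, norm_pow, Complex.norm_of_nonneg hq, Complex.norm_of_nonneg hr, norm_real,
    Real.norm_eq_abs, sq_abs]
  ring

theorem sqrt_add_ofReal_ne_zero {z : ℂ} (hz : 0 < z.re) {b : ℝ} (hb : 0 ≤ b) :
    Complex.sqrt z + b ≠ 0 := by
  intro h
  have := congrArg re h
  rw [add_re, ofReal_re, zero_re] at this
  linarith [Complex.sqrt_re_pos hz]

theorem sub_mul_ne_zero {R : ℝ} (hr : 0 < r) (hrp : R * r < p) (hx : ‖x‖ ≤ R) :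
    (p - r * x : ℂ) ≠ 0 := by
  intro h
  have h1 := congrArg norm (sub_eq_zero.1 h)
  rw [norm_mul, Complex.norm_of_nonneg hr.le, norm_real, Real.norm_eq_abs] at h1
  nlinarith [le_abs_self p]

theorem differentiableOn_axisSeries {R : ℝ} (hq : 0 < q) (hr : 0 < r) (hrp : R * r < p)
    (hR : R * (q * r * w ^ 2) < 1) : DifferentiableOn ℂ (axisSeries c p q r w) (ball 0 R) := by
  intro x hx
  have hx' : ‖x‖ < R := by simpa using hx
  have hre : 0 < (1 - x * q * r * w ^ 2).re := by
    apply Complex.re_one_sub_pos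
    rw [norm_mul_mul_mul_sq hq.le hr.le]
    refine lt_of_le_of_lt ?_ hR
    gcongr
  apply DifferentiableAt.differentiableWithinAt
  have h1 : DifferentiableAt ℂ (fun x : ℂ => Complex.sqrt (1 - x * q * r * w ^ 2)) x := by
    unfold Complex.sqrt
    exact DifferentiableAt.cpow_const (by fun_prop) (Or.inl hre)
  unfold axisSeries
  refine DifferentiableAt.div (by fun_prop) (by fun_prop) ?_
  exact mul_ne_zero (sub_mul_ne_zero hr hrp hx'.le)
    (sqrt_add_ofReal_ne_zero hre (Real.sqrt_nonneg _))

/-- Multiplying the stated formula by the conjugate sum `s + b` exposes the factor `p - q x`, which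
cancels. `axisSeries` is the cancelled form, regular at `q x = p`. -/
theorem axisSeries_eq (hp : p ≠ 0) (hw : w ≠ 0) (hq : q ≠ 0) (hpr : 0 ≤ 1 - p * r * w ^ 2)
    (hre : 0 < (1 - x * q * r * w ^ 2).re)
    (hrx : (p - r * x : ℂ) ≠ 0) (hqx : (q * x : ℂ) ≠ p) :
    axisSeries c p q r w x = c / ((1 - q * x / p) * (1 - r * x / p)) *
      ((1 - x / (p * w)) * Complex.sqrt (1 - x * q * r * w ^ 2) -
        q * x / p * (1 - 1 / (q * w)) * Complex.sqrt (1 - p * r * w ^ 2)) := by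
  have hb : Complex.sqrt (1 - p * r * w ^ 2) = (√(1 - p * r * w ^ 2) : ℝ) := by
    rw [← Complex.sqrt_ofReal hpr]
    push_cast
    rfl
  have hb2 : ((√(1 - p * r * w ^ 2) : ℝ) : ℂ) ^ 2 = 1 - p * r * w ^ 2 := by
    rw [← hb, Complex.sqrt_sq]
  have hs2 := Complex.sqrt_sq (1 - x * q * r * w ^ 2)
  have hsb := sqrt_add_ofReal_ne_zero hre (Real.sqrt_nonneg (1 - p * r * w ^ 2))
  rw [hb]
  unfold axisSeries
  generalize Complex.sqrt (1 - x * q * r * w ^ 2) = s at *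
  generalize ((√(1 - p * r * w ^ 2) : ℝ) : ℂ) = b at *
  have hp' : (p : ℂ) ≠ 0 := by exact_mod_cast hp
  have hq' : (q : ℂ) ≠ 0 := by exact_mod_cast hq
  have hw' : (w : ℂ) ≠ 0 := by exact_mod_cast hw
  have hqx' : (p - q * x : ℂ) ≠ 0 := sub_ne_zero.2 hqx.symm
  have key : ((p * w - x) * s - x * (q * w - 1) * b) * (s + b) =
      w * (p - q * x) * (1 + s * b - r * w * x) := by
    linear_combination (p * w - x) * hs2 - x * (q * w - 1) * hb2
  have e1 : (1 - q * x / p : ℂ) = (p - q * x) / p := by field_simp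
  have e2 : (1 - r * x / p : ℂ) = (p - r * x) / p := by field_simp
  have e3 : (1 - x / (p * w)) * s - q * x / p * (1 - 1 / (q * w)) * b =
      ((p * w - x) * s - x * (q * w - 1) * b) / (p * w) := by field_simp
  rw [e1, e2, e3, eq_div_of_mul_eq hsb key]
  generalize (p - q * x : ℂ) = u at *
  generalize (p - r * x : ℂ) = v at *
  field_simp

theorem axisSeries_zero (hp : p ≠ 0) : axisSeries c p q r w 0 = c := by
  have hp' : (p : ℂ) ≠ 0 := by exact_mod_cast hp
  have hb : (1 + (√(1 - p * r * w ^ 2) : ℝ) : ℂ) ≠ 0 := by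
    have := Real.sqrt_nonneg (1 - p * r * w ^ 2)
    exact_mod_cast (by positivity : (0 : ℝ) < 1 + √(1 - p * r * w ^ 2)).ne'
  unfold axisSeries
  simp only [zero_mul, sub_zero, Complex.sqrt_one, one_mul, mul_zero]
  field_simp

theorem axisSeries_of_eq (hr : 0 < r) (hpr : r < p) (hx : ‖x‖ ≤ 1) :
    axisSeries c p p r (1 / p) x = c / Complex.sqrt (1 - r * x / p) := by
  have hp := hr.trans hpr
  have hp' : (p : ℂ) ≠ 0 := by exact_mod_cast hp.ne'
  have e : 1 - x * p * r * ((1 / p : ℝ) : ℂ) ^ 2 = 1 - r * x / p := by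
    push_cast
    field_simp
  have hre : 0 < (1 - r * x / p).re := by
    apply Complex.re_one_sub_pos
    rw [norm_div, norm_mul, Complex.norm_of_nonneg hr.le, Complex.norm_of_nonneg hp.le, div_lt_one hp]
    exact (mul_le_of_le_one_right hr.le hx).trans_lt hpr
  have hs0 : Complex.sqrt (1 - r * x / p) ≠ 0 := by
    intro h
    have := Complex.sqrt_re_pos hre
    rw [h, zero_re] at this
    exact this.false
  have hsb := sqrt_add_ofReal_ne_zero hre (Real.sqrt_nonneg (1 - p * r * (1 / p) ^ 2))
  have hs2 := Complex.sqrt_sq (1 - r * x / p)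
  have hrx : (p - r * x : ℂ) ≠ 0 := sub_mul_ne_zero (R := 1) hr (by linarith) hx
  have hnum : (p - r * x : ℂ) = p * Complex.sqrt (1 - r * x / p) ^ 2 := by
    rw [hs2]
    field_simp
  unfold axisSeries
  rw [e]
  generalize Complex.sqrt (1 - r * x / p) = s at *
  rw [div_eq_div_iff (mul_ne_zero hrx hsb) hs0]
  have e2 : (r * ((1 / p : ℝ) : ℂ) * x : ℂ) = 1 - s ^ 2 := by
    rw [hs2]
    push_cast
    field_simp
    ring
  rw [e2, hnum]
  ring

/-- The algebraic identity behind the vanishing of the numerator with the kernel. -/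
theorem kernel_identity {a b s t P Q R x y : ℂ} (hR : R = 1 - a * b) (hQR : Q * R = 1 - a ^ 2)
    (hPR : P * R = 1 - b ^ 2) (hs : Q * R * x = 1 - s ^ 2) (ht : P * R * y = 1 - t ^ 2)
    (hst : s * t = 1 - R * x * y) (hP : P ≠ 0) (hQ : Q ≠ 0) (hR0 : R ≠ 0) :
    x * (y - 1) * (s + a) * (R * t + b - a) * (t + a) +
      y * (x - 1) * (t + b) * (R * s + a - b) * (s + b) = 0 := by
  have hG : (1 - s * t) * (Q * R) * (P * R) - R * ((Q * R * x) * (P * R * y)) = 0 := by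
    rw [hst]
    ring
  -- After scaling, `x`, `y`, `P`, `Q`, `R` can all be expressed through `a`, `b`, `s`, `t`, and the
  -- relation for `s * t` splits off as a factor.
  have hmul : (Q * R) * (P * R) * (x * (y - 1) * (s + a) * (R * t + b - a) * (t + a) +
      y * (x - 1) * (t + b) * (R * s + a - b) * (s + b)) = -(s + a) * (t + b) * (s + t) *
        ((1 - s * t) * (Q * R) * (P * R) - R * ((Q * R * x) * (P * R * y))) := by
    have e : (Q * R) * (P * R) * (x * (y - 1) * (s + a) * (R * t + b - a) * (t + a) +
      y * (x - 1) * (t + b) * (R * s + a - b) * (s + b)) =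
        (Q * R * x) * (P * R * y - P * R) * (s + a) * (R * t + b - a) * (t + a) +
        (P * R * y) * (Q * R * x - Q * R) * (t + b) * (R * s + a - b) * (s + b) := by ring
    rw [e, hs, ht, hQR, hPR, hR]
    ring
  rw [hG, mul_zero] at hmul
  exact (mul_eq_zero.1 hmul).resolve_left
    (mul_ne_zero (mul_ne_zero hQ hR0) (mul_ne_zero hP hR0))

/-- The first identity rewrites the axis function so that `kernel_identity` applies; the second
shows that the new denominator is nonzero when `P - R x` is. -/
theorem kernel_factor {a b s P Q R x : ℂ} (hR : R = 1 - a * b) (hQR : Q * R = 1 - a ^ 2)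
    (hPR : P * R = 1 - b ^ 2) (hs : Q * R * x = 1 - s ^ 2) (hQ : Q ≠ 0) (hR0 : R ≠ 0) :
    (1 + s * b - R * x) * (R * s + a - b) = (P - R * x) * ((s + a) * R) ∧
      Q * R ^ 2 * (P - R * x) = (R * s + a - b) * (R * s - a + b) := by
  constructor
  · apply mul_left_cancel₀ (mul_ne_zero hQ hR0)
    have e1 : Q * R * ((1 + s * b - R * x) * (R * s + a - b)) =
      (Q * R + s * b * (Q * R) - R * (Q * R * x)) * (R * s + a - b) := by ring
    have e2 : Q * R * ((P - R * x) * ((s + a) * R)) =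
      ((Q * R) * (P * R) - R ^ 2 * (Q * R * x)) * (s + a) := by ring
    rw [e1, e2, hs, hPR, hQR, hR]
    ring
  · have e : Q * R ^ 2 * (P - R * x) = (Q * R) * (P * R) - R ^ 2 * (Q * R * x) := by ring
    rw [e, hs, hPR, hQR, hR]
    ring

/-- This is the relation `s t = 1 - rwxy` at `x = y = 1`, which lies on the kernel curve as `p + q +
r = 1`. -/
theorem sqrt_mul_sqrt_eq (hpr : 0 ≤ 1 - p * r * w ^ 2)
    (hw : w = 2 + p * q * r * w ^ 3) (hpqr : p + q + r = 1) (hrw : r * w ≤ 1) :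
    √(1 - q * r * w ^ 2) * √(1 - p * r * w ^ 2) = 1 - r * w := by
  rw [← Real.sqrt_mul' _ hpr, ← Real.sqrt_sq (sub_nonneg.2 hrw)]
  congr 1
  have hp : p = 1 - q - r := by linarith
  subst hp
  linear_combination (-r * w) * hw

theorem numerator_eq_zero (c : ℝ) {R : ℝ} {y : ℂ} (hp : 0 < p) (hq : 0 < q) (hr : 0 < r)
    (hw0 : 0 < w) (hpqr : p + q + r = 1) (hw : w = 2 + p * q * r * w ^ 3) (hR : 1 ≤ R)
    (hrp : R * r < p) (hrq : R * r < q) (hqr : R * (q * r * w ^ 2) < 1)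
    (hpr : R * (p * r * w ^ 2) < 1) (hrw : R ^ 2 * (r * w) < 1) (hx : ‖x‖ ≤ R) (hy : ‖y‖ ≤ R)
    (hK : -r * x ^ 2 * y ^ 2 + (x - p) * y + -q * x = 0) :
    q * x * (y - 1) * axisSeries c p q r w x + p * y * (x - 1) * axisSeries c q p r w y = 0 := by
  have hpr1 : p * r * w ^ 2 ≤ 1 := by nlinarith [show 0 ≤ p * r * w ^ 2 by positivity]
  have hqr1 : q * r * w ^ 2 ≤ 1 := by nlinarith [show 0 ≤ q * r * w ^ 2 by positivity]
  have hrw1 : r * w ≤ 1 := by nlinarith [show 0 ≤ r * w by positivity, sq_nonneg (R - 1)]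
  have hab := sqrt_mul_sqrt_eq (sub_nonneg.2 hpr1) hw hpqr hrw1
  have ha2 := Real.sq_sqrt (sub_nonneg.2 hqr1)
  have hb2 := Real.sq_sqrt (sub_nonneg.2 hpr1)
  have hxre : 0 < (1 - x * q * r * w ^ 2).re := by
    apply Complex.re_one_sub_pos
    rw [norm_mul_mul_mul_sq hq.le hr.le]
    refine lt_of_le_of_lt ?_ hqr
    gcongr
  have hyre : 0 < (1 - y * p * r * w ^ 2).re := by
    apply Complex.re_one_sub_pos
    rw [norm_mul_mul_mul_sq hp.le hr.le]
    refine lt_of_le_of_lt ?_ hpr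
    gcongr
  have hxyre : 0 < (1 - r * w * x * y).re := by
    apply Complex.re_one_sub_pos
    rw [norm_mul, norm_mul, norm_mul, Complex.norm_of_nonneg hr.le, Complex.norm_of_nonneg hw0.le]
    refine lt_of_le_of_lt ?_ hrw
    calc r * w * ‖x‖ * ‖y‖ ≤ r * w * R * R := by gcongr
      _ = _ := by ring
  have hs2 := Complex.sqrt_sq (1 - x * q * r * w ^ 2)
  have ht2 := Complex.sqrt_sq (1 - y * p * r * w ^ 2)
  have hst : Complex.sqrt (1 - x * q * r * w ^ 2) * Complex.sqrt (1 - y * p * r * w ^ 2) =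
      1 - r * w * x * y := by
    have hpos := Complex.sqrt_mul_sqrt_re_pos hxre hyre
    have hw' : (w : ℂ) = 2 + p * q * r * w ^ 3 := by exact_mod_cast hw
    -- The kernel replaces `q x + p y` by `x y - r x² y²`, and the cubic for `w` completes the
    -- square. The sign then follows since both sides have positive real part.
    have hsq : (Complex.sqrt (1 - x * q * r * w ^ 2) * Complex.sqrt (1 - y * p * r * w ^ 2)) ^ 2 =
        (1 - r * w * x * y) ^ 2 := by
      rw [mul_pow, hs2, ht2]
      linear_combination r * w ^ 2 * hK - r * w * x * y * hw'
    rcases sq_eq_sq_iff_eq_or_eq_neg.1 hsq with h | h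
    · exact h
    · rw [h, neg_re] at hpos
      linarith
  have hsb := sqrt_add_ofReal_ne_zero hxre (Real.sqrt_nonneg (1 - p * r * w ^ 2))
  have hta := sqrt_add_ofReal_ne_zero hyre (Real.sqrt_nonneg (1 - q * r * w ^ 2))
  have hpx := sub_mul_ne_zero hr hrp hx
  have hqy := sub_mul_ne_zero hr hrq hy
  unfold axisSeries
  generalize Complex.sqrt (1 - x * q * r * w ^ 2) = s at *
  generalize Complex.sqrt (1 - y * p * r * w ^ 2) = t at *
  generalize √(1 - q * r * w ^ 2) = a at *
  generalize √(1 - p * r * w ^ 2) = b at *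
  have hp' : (p : ℂ) ≠ 0 := by exact_mod_cast hp.ne'
  have hq' : (q : ℂ) ≠ 0 := by exact_mod_cast hq.ne'
  have hr' : (r : ℂ) ≠ 0 := by exact_mod_cast hr.ne'
  have hw' : (w : ℂ) ≠ 0 := by exact_mod_cast hw0.ne'
  have hR : (r * w : ℂ) = 1 - a * b := by
    have : r * w = 1 - a * b := by linarith
    exact_mod_cast this
  have hQR : (q * w * (r * w) : ℂ) = 1 - a ^ 2 := by
    have : q * w * (r * w) = 1 - a ^ 2 := by linarith
    exact_mod_cast this
  have hPR : (p * w * (r * w) : ℂ) = 1 - b ^ 2 := by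
    have : p * w * (r * w) = 1 - b ^ 2 := by linarith
    exact_mod_cast this
  have hsx : (q * w * (r * w) * x : ℂ) = 1 - s ^ 2 := by rw [hs2]; ring
  have hty : (p * w * (r * w) * y : ℂ) = 1 - t ^ 2 := by rw [ht2]; ring
  have hid := kernel_identity hR hQR hPR hsx hty hst (mul_ne_zero hp' hw') (mul_ne_zero hq' hw')
    (mul_ne_zero hr' hw')
  obtain ⟨hx1, hx2⟩ := kernel_factor hR hQR hPR hsx (mul_ne_zero hq' hw') (mul_ne_zero hr' hw')
  obtain ⟨hy1, hy2⟩ := kernel_factor (hR.trans (by ring)) hPR hQR hty (mul_ne_zero hp' hw')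
    (mul_ne_zero hr' hw')
  have hE1 : (r * w * s + a - b : ℂ) ≠ 0 := by
    apply left_ne_zero_of_mul (b := (r * w * s - a + b : ℂ))
    rw [← hx2, show (p * w - r * w * x : ℂ) = w * (p - r * x) by ring]
    exact mul_ne_zero (mul_ne_zero (mul_ne_zero hq' hw') (pow_ne_zero _ (mul_ne_zero hr' hw')))
      (mul_ne_zero hw' hpx)
  have hE2 : (r * w * t + b - a : ℂ) ≠ 0 := by
    apply left_ne_zero_of_mul (b := (r * w * t - b + a : ℂ))
    rw [← hy2, show (q * w - r * w * y : ℂ) = w * (q - r * y) by ring]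
    exact mul_ne_zero (mul_ne_zero (mul_ne_zero hp' hw') (pow_ne_zero _ (mul_ne_zero hr' hw')))
      (mul_ne_zero hw' hqy)
  have ex : (1 + s * b - r * w * x : ℂ) / (p - r * x) = w * ((s + a) * (r * w)) /
      (r * w * s + a - b) := by
    rw [div_eq_div_iff hpx hE1]
    linear_combination hx1
  have ey : (1 + t * a - r * w * y : ℂ) / (q - r * y) = w * ((t + b) * (r * w)) /
      (r * w * t + b - a) := by
    rw [div_eq_div_iff hqy hE2]
    linear_combination hy1
  have ex' : c * p * (1 + s * b - r * w * x) / ((p - r * x) * (s + b)) =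
      c * p * (w * ((s + a) * (r * w)) / (r * w * s + a - b)) / (s + b) := by
    rw [← ex]
    field_simp
  have ey' : c * q * (1 + t * a - r * w * y) / ((q - r * y) * (t + a)) =
      c * q * (w * ((t + b) * (r * w)) / (r * w * t + b - a)) / (t + a) := by
    rw [← ey]
    field_simp
  rw [ex', ey']
  clear ex ey ex' ey' hx1 hx2 hy1 hy2
  generalize (r * w * s + a - b : ℂ) = u at *
  generalize (r * w * t + b - a : ℂ) = v at *
  field_simp
  linear_combination (q * c * p * w ^ 2 * r) * hid

end AxisSeries

/-! ### The normalizing constant and existence of the solution. -/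

section Existence

open Filter Topology

variable {p q r w : ℝ}

theorem isLeast_cubic_root_perm {p' q' r' : ℝ}
    (hw : IsLeast {z : ℝ | 0 < z ∧ z = 2 + p * q * r * z ^ 3} w)
    (h : p' * q' * r' = p * q * r) : IsLeast {z : ℝ | 0 < z ∧ z = 2 + p' * q' * r' * z ^ 3} w := by
  rwa [h]

variable (hp : 0 < p) (hq : 0 < q) (hr : 0 < r) (hpqr : p + q + r = 1) (hrp : r < p) (hrq : r < q)
  (hw : IsLeast {z : ℝ | 0 < z ∧ z = 2 + p * q * r * z ^ 3} w)

include hp hq hr hpqr hw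

-- The cubic is symmetric in `p`, `q`, `r`, so the bound on `p q w²` may be permuted.
include hrq in
theorem mul_mul_cubic_root_sq_lt_one_right : q * r * w ^ 2 < 1 :=
  mul_mul_cubic_root_sq_lt_one hq hr hp (by linarith)
    (isLeast_cubic_root_perm hw (by ring)) hrq.ne'

include hrp in
theorem mul_mul_cubic_root_sq_lt_one_left : p * r * w ^ 2 < 1 :=
  mul_mul_cubic_root_sq_lt_one hp hr hq (by linarith)
    (isLeast_cubic_root_perm hw (by ring)) hrp.ne'

/-- The value `Q(0, 0)` of the normalized solution. -/
noncomputable def originMass (p q r w : ℝ) : ℝ :=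
  (p - r) * (q - r) * (√(1 - q * r * w ^ 2) + √(1 - p * r * w ^ 2)) / (6 * p * q * (1 - r * w))

omit hp hq hr hpqr hw in
theorem originMass_swap (p q r w : ℝ) : originMass q p r w = originMass p q r w := by
  unfold originMass
  ring

include hrp hrq

theorem originMass_pos : 0 < originMass p q r w := by
  have h1 := mul_cubic_root_lt_one hp hq hr hpqr hw hrp hrq
  have h2 := sub_pos.2 (mul_mul_cubic_root_sq_lt_one_right hp hq hr hpqr hrq hw)
  have h3 := sub_pos.2 hrp
  have h4 := sub_pos.2 hrq
  have h5 := sub_pos.2 h1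
  have h6 := Real.sqrt_pos.2 h2
  unfold originMass
  positivity

theorem sqrt_mul_sqrt_cubic_root :
    √(1 - q * r * w ^ 2) * √(1 - p * r * w ^ 2) = 1 - r * w :=
  sqrt_mul_sqrt_eq (sub_nonneg.2 (mul_mul_cubic_root_sq_lt_one_left hp hq hr hpqr hrp hw).le)
    hw.1.2 hpqr (mul_cubic_root_lt_one hp hq hr hpqr hw hrp hrq).le

theorem originMass_of_ne (hne : p ≠ q) : originMass p q r w = w * (p - r) * (q - r) * |p - q| /
    (6 * p * q * (1 - r * w) * √(1 - p * q * w ^ 2)) := by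
  have hw0 : 0 < w := hw.1.1
  have h1 := mul_cubic_root_lt_one hp hq hr hpqr hw hrp hrq
  have h2 := mul_mul_cubic_root_sq_lt_one hp hq hr hpqr hw hne
  have ha := Real.sq_sqrt
    (sub_nonneg.2 (mul_mul_cubic_root_sq_lt_one_right hp hq hr hpqr hrq hw).le)
  have hb := Real.sq_sqrt
    (sub_nonneg.2 (mul_mul_cubic_root_sq_lt_one_left hp hq hr hpqr hrp hw).le)
  have hab := sqrt_mul_sqrt_cubic_root hp hq hr hpqr hrp hrq hw
  have hc := Real.sq_sqrt (sub_nonneg.2 h2.le)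
  have hcpos := Real.sqrt_pos.2 (sub_pos.2 h2)
  -- Both sides are nonnegative; after squaring, the cross term is known from `hab` and the cubic
  -- does the rest.
  have key : (√(1 - q * r * w ^ 2) + √(1 - p * r * w ^ 2)) * √(1 - p * q * w ^ 2) =
      w * |p - q| := by
    rw [← sq_eq_sq₀ (by positivity) (by positivity), mul_pow, mul_pow, sq_abs, hc, add_sq, ha, hb,
      mul_assoc 2, hab]
    have hr' : r = 1 - p - q := by linarith
    have := hw.1.2
    rw [hr'] at this ⊢
    linear_combination -(2 + (p + q) * w) * this
  have h3 : 1 - r * w ≠ 0 := (sub_pos.2 h1).ne'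
  unfold originMass
  rw [div_eq_div_iff (by positivity) (by positivity)]
  linear_combination (p - r) * (q - r) * (6 * p * q * (1 - r * w)) * key

theorem originMass_of_eq (heq : p = q) :
    originMass p q r w = 1 / 3 * (1 - r / p) ^ (3 / 2 : ℝ) := by
  have hwe := cubic_root_eq hp hq hr hpqr hw hrp heq
  subst heq
  have h0 : 0 < 1 - r / p := by
    rw [sub_pos, div_lt_one hp]
    exact hrp
  have e : 1 - p * r * w ^ 2 = 1 - r / p := by
    rw [hwe]
    field_simp
  have hrpow : (1 - r / p) ^ (3 / 2 : ℝ) = (1 - r / p) * √(1 - r / p) := by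
    rw [show (3 / 2 : ℝ) = 1 + 1 / 2 by norm_num, Real.rpow_add h0, Real.rpow_one,
      Real.sqrt_eq_rpow]
  unfold originMass
  rw [e, hrpow, hwe]
  generalize √(1 - r / p) = s
  have : p - r ≠ 0 := (sub_pos.2 hrp).ne'
  have e2 : 1 - r / p = (p - r) / p := by field_simp
  have e3 : 1 - r * (1 / p) = (p - r) / p := by field_simp
  rw [e2, e3]
  field_simp
  ring

/-- `originMass` is chosen for this value: by the cut equation it corresponds to total mass `1 / 3`
of the balanced array. -/
theorem axisSeries_one : axisSeries (originMass p q r w) p q r w 1 = ((q - r) / (3 * q) : ℝ) := by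
  have h1 := mul_cubic_root_lt_one hp hq hr hpqr hw hrp hrq
  have hqr := sub_pos.2 (mul_mul_cubic_root_sq_lt_one_right hp hq hr hpqr hrq hw)
  have hab := sqrt_mul_sqrt_cubic_root hp hq hr hpqr hrp hrq hw
  have hs : Complex.sqrt (1 - 1 * q * r * w ^ 2) = (√(1 - q * r * w ^ 2) : ℝ) := by
    rw [← Complex.sqrt_ofReal hqr.le]
    push_cast
    rw [one_mul]
  have hapos := Real.sqrt_pos.2 hqr
  have hbnn := Real.sqrt_nonneg (1 - p * r * w ^ 2)
  unfold axisSeries originMass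
  rw [hs]
  generalize √(1 - q * r * w ^ 2) = a at *
  generalize √(1 - p * r * w ^ 2) = b at *
  have h2 : 1 - r * w ≠ 0 := (sub_pos.2 h1).ne'
  have h3 : p - r ≠ 0 := (sub_pos.2 hrp).ne'
  have h4 : a + b ≠ 0 := by positivity
  have key : (p - r) * (q - r) * (a + b) / (6 * p * q * (1 - r * w)) * p *
      (1 + a * b - r * w * 1) / ((p - r * 1) * (a + b)) = (q - r) / (3 * q) := by
    rw [hab, mul_one, mul_one, show 1 + (1 - r * w) - r * w = 2 * (1 - r * w) by ring]
    field_simp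
    ring
  exact_mod_cast key

/-- The solution of the balance equations with the explicit values on the axes. -/
theorem exists_isBalanced_axisSeries : ∃ b : ℕ × ℕ → ℝ, (∀ n, 0 ≤ b n) ∧ Summable b ∧
    IsBalanced p q r b ∧ b (0, 0) = originMass p q r w ∧
    (∀ x : ℂ, ‖x‖ ≤ 1 → HasSum (fun i => (b (i, 0) : ℂ) * x ^ i)
      (axisSeries (originMass p q r w) p q r w x)) ∧
    ∀ y : ℂ, ‖y‖ ≤ 1 → HasSum (fun j => (b (0, j) : ℂ) * y ^ j)
      (axisSeries (originMass p q r w) q p r w y) := by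
  -- Each condition is strict at `R = 1`, so some `R > 1` satisfies all. The first, times `R - 1`,
  -- becomes the torus bound `hS'`; `2 * R - 1` serves as the larger radius.
  have hev : ∀ᶠ R in 𝓝 (1 : ℝ), r * (R ^ 2 + R + 1) < 1 ∧ r * R ^ 3 < p ∧ r * R ^ 3 < q ∧
      (2 * R - 1) * (q * r * w ^ 2) < 1 ∧ (2 * R - 1) * (p * r * w ^ 2) < 1 ∧
      R ^ 2 * (r * w) < 1 ∧ (2 * R - 1) * r < p ∧ (2 * R - 1) * r < q := by
    have key : ∀ (f : ℝ → ℝ) (c : ℝ), Continuous f → f 1 < c → ∀ᶠ R in 𝓝 (1 : ℝ), f R < c :=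
      fun f c hf h => hf.continuousAt.eventually_lt_const h
    have h1 := mul_cubic_root_lt_one hp hq hr hpqr hw hrp hrq
    have h2 := mul_mul_cubic_root_sq_lt_one_right hp hq hr hpqr hrq hw
    have h3 := mul_mul_cubic_root_sq_lt_one_left hp hq hr hpqr hrp hw
    refine (key _ _ (by fun_prop) ?_).and ((key _ _ (by fun_prop) ?_).and
      ((key _ _ (by fun_prop) ?_).and ((key _ _ (by fun_prop) ?_).and
      ((key _ _ (by fun_prop) ?_).and ((key _ _ (by fun_prop) ?_).and
      ((key _ _ (by fun_prop) ?_).and (key _ _ (by fun_prop) ?_))))))) <;> linarith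
  obtain ⟨R, ⟨hS, hrp3, hrq3, hqr, hpr, hrw, hrp', hrq'⟩, hR1⟩ :=
    ((hev.filter_mono nhdsWithin_le_nhds).and (self_mem_nhdsWithin (s := Set.Ioi (1 : ℝ)))).exists
  have hR : 1 < R := hR1
  have hR0 : 0 < R := zero_lt_one.trans hR
  have hS' : p / R + q / R + r * R ^ 2 < 1 := by
    rw [← add_div, div_add' _ _ _ hR0.ne', div_lt_one hR0]
    nlinarith [mul_lt_mul_of_pos_left hS (sub_pos.2 hR)]
  have hle : R ≤ 2 * R - 1 := by linarith
  have hw0 : 0 < w := hw.1.1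
  have hc := originMass_pos hp hq hr hpqr hrp hrq hw
  obtain ⟨a, has, hab, hax, hay⟩ := exists_isBalanced_of_kernel (R' := 2 * R - 1)
    (h := axisSeries (originMass p q r w) p q r w) (g := axisSeries (originMass p q r w) q p r w)
    hr hp hq hR (by linarith) hS' hrp3 hrq3 (differentiableOn_axisSeries hq hr hrp' hqr)
    (differentiableOn_axisSeries hp hr hrq' hpr) fun x y hx hy hK =>
      numerator_eq_zero _ hp hq hr hw0 hpqr hw.1.2 hR.le
        ((mul_le_mul_of_nonneg_right hle hr.le).trans_lt hrp')
        ((mul_le_mul_of_nonneg_right hle hr.le).trans_lt hrq')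
        ((mul_le_mul_of_nonneg_right hle (by positivity)).trans_lt hqr)
        ((mul_le_mul_of_nonneg_right hle (by positivity)).trans_lt hpr) hrw hx hy hK
  have ha0 : a (0, 0) = originMass p q r w := by
    have h1 := hax 0 (by simp)
    rw [axisSeries_zero hp.ne'] at h1
    refine HasSum.unique ?_ h1
    refine (hasSum_ite_eq 0 (a (0, 0))).congr_fun fun i => ?_
    by_cases h : i = 0 <;> simp [h]
  have hn0 : ‖a (0, 0)‖ = originMass p q r w := by
    rw [ha0, Complex.norm_of_nonneg hc.le]
  have hae := hab.eq_norm hp hq hr.le hpqr has (by rw [hn0, ha0])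
  refine ⟨fun n => ‖a n‖, fun n => norm_nonneg _, has.norm, hab.norm hp.le hq.le hr.le hpqr has,
    hn0, fun x hx => ?_, fun y hy => ?_⟩
  · exact (hax x hx).congr_fun fun i => by rw [congrFun hae (i, 0)]
  · exact (hay y hy).congr_fun fun j => by rw [congrFun hae (0, j)]

end Existence

/-! ### Generating functions with the axes removed. -/

section GeneratingFunction

theorem summable_pow_mul_pow {a : ℕ × ℕ → ℂ} (ha : Summable a) {x y : ℂ} (hx : ‖x‖ ≤ 1)
    (hy : ‖y‖ ≤ 1) : Summable fun n : ℕ × ℕ => a n * x ^ n.1 * y ^ n.2 := by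
  refine Summable.of_norm_bounded ha.norm fun n => ?_
  rw [norm_mul, norm_mul, norm_pow, norm_pow]
  exact (mul_le_of_le_one_right (by positivity) (pow_le_one₀ (norm_nonneg _) hy)).trans
    (mul_le_of_le_one_right (norm_nonneg _) (pow_le_one₀ (norm_nonneg _) hx))

theorem hasSum_succ_mul_pow_succ {a : ℕ → ℂ} {x s t : ℂ} (hs : HasSum (fun i => a i * x ^ i) s)
    (ht : a 0 = t) : HasSum (fun i => a (i + 1) * x ^ (i + 1)) (s - t) := by
  have h := (hasSum_nat_add_iff' (f := fun i => a i * x ^ i) 1).2 hs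
  simpa [ht] using h

theorem hasSum_succ_succ {u : ℕ × ℕ → ℂ} {s t t' o : ℂ} (hs : HasSum u s)
    (ht : HasSum (fun i => u (i, 0)) t) (ht' : HasSum (fun j => u (0, j)) t') (ho : u (0, 0) = o) :
    HasSum (fun n : ℕ × ℕ => u (n.1 + 1, n.2 + 1)) (s - t - t' + o) := by
  have h0 : HasSum (fun i => u (i + 1, 0)) (t - o) := by
    simpa [ho] using (hasSum_nat_add_iff' (f := fun i => u (i, 0)) 1).2 ht
  have h := hasSum_succ_snd (u := fun n : ℕ × ℕ => u (n.1 + 1, n.2)) (hasSum_succ_fst hs ht') h0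
  rwa [show s - t' - (t - o) = s - t - t' + o by ring] at h

end GeneratingFunction

/-! ### Assembly of the theorem. -/

theorem mainTheorem5 (p q r p' r' q'' r'' : ℝ)
    (hp : 0 < p) (hq : 0 < q) (hr : 0 < r) (hpqr : p + q + r = 1)
    (hp' : 0 < p') (hr' : 0 < r') (hpr' : p' + r' = 1)
    (hq'' : 0 < q'') (hr'' : 0 < r'') (hqr'' : q'' + r'' = 1)
    (hα : p / r = p' / r') (hβ : q / r = q'' / r'') :
    (r < min p q →
      ∃ w : ℝ, IsLeast {z : ℝ | 0 < z ∧ z = 2 + p * q * r * z ^ 3} w ∧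
      ∃ π : ℕ × ℕ → ℝ,
        IsStationaryDistribution (quadrantTransition p q r p' r' q'' r'') π ∧
        (∀ π' : ℕ × ℕ → ℝ,
          IsStationaryDistribution (quadrantTransition p q r p' r' q'' r'') π' → π' = π) ∧
        -- the value of `p_{0,0}`
        (p ≠ q → π (0, 0) =
          w * (p - r) * (q - r) * |p - q| /
            (6 * p * q * (1 - r * w) * Real.sqrt (1 - p * q * w ^ 2))) ∧
        (p = q → π (0, 0) = 1 / 3 * (1 - r / p) ^ (3 / 2 : ℝ)) ∧
        ∃ Q : ℂ → ℂ → ℂ,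
          -- `Q` is the unique solution of the functional equation with `Q(0,0) = p_{0,0}`
          IsFlattoHahnSolution p q r Q ∧ Q 0 0 = (π (0, 0) : ℂ) ∧
          (∀ Q' : ℂ → ℂ → ℂ, IsFlattoHahnSolution p q r Q' → Q' 0 0 = (π (0, 0) : ℂ) →
            ∀ x y : ℂ, ‖x‖ ≤ 1 → ‖y‖ ≤ 1 → Q' x y = Q x y) ∧
          -- explicit expressions of `Q(x,0)` and `Q(0,y)`
          (∀ x : ℂ, ‖x‖ ≤ 1 → q * x ≠ p →
            Q x 0 = Q 0 0 / ((1 - q * x / p) * (1 - r * x / p)) *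
              ((1 - x / (p * w)) * Complex.sqrt (1 - x * q * r * w ^ 2) -
                q * x / p * (1 - 1 / (q * w)) * Complex.sqrt (1 - p * r * w ^ 2))) ∧
          (∀ y : ℂ, ‖y‖ ≤ 1 → p * y ≠ q →
            Q 0 y = Q 0 0 / ((1 - p * y / q) * (1 - r * y / q)) *
              ((1 - y / (q * w)) * Complex.sqrt (1 - y * p * r * w ^ 2) -
                p * y / q * (1 - 1 / (p * w)) * Complex.sqrt (1 - q * r * w ^ 2))) ∧
          (p = q → w = 1 / p ∧ ∀ x : ℂ, ‖x‖ ≤ 1 →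
            Q x 0 = Q 0 0 / Complex.sqrt (1 - r * x / p) ∧
            Q 0 x = Q 0 0 / Complex.sqrt (1 - r * x / p)) ∧
          -- the generating functions of the stationary distribution
          (∀ x : ℂ, ‖x‖ ≤ 1 →
            HasSum (fun i : ℕ => (π (i + 1, 0) : ℂ) * x ^ (i + 1))
              (1 / r' * (Q x 0 - Q 0 0))) ∧
          (∀ y : ℂ, ‖y‖ ≤ 1 →
            HasSum (fun j : ℕ => (π (0, j + 1) : ℂ) * y ^ (j + 1))
              (1 / r'' * (Q 0 y - Q 0 0))) ∧
          (∀ x y : ℂ, ‖x‖ ≤ 1 → ‖y‖ ≤ 1 →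
            HasSum
              (fun n : ℕ × ℕ => (π (n.1 + 1, n.2 + 1) : ℂ) * x ^ (n.1 + 1) * y ^ (n.2 + 1))
              (1 / r * (Q x y - Q x 0 - Q 0 y + Q 0 0)))) ∧
    (min p q ≤ r →
      ¬ ∃ π : ℕ × ℕ → ℝ,
        IsStationaryDistribution (quadrantTransition p q r p' r' q'' r'') π) := by
  refine ⟨fun hlt => ?_, fun h ⟨π, hπ⟩ =>
    not_isStationaryDistribution_of_le hp hq hr hpqr hr' hpr' hr'' hqr'' hα hβ h π hπ⟩
  obtain ⟨hrp, hrq⟩ := lt_min_iff.1 hlt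
  obtain ⟨w, hw⟩ := exists_isLeast_cubic_root hp hq hr hpqr
  have hqpr : q + p + r = 1 := by linarith
  have hws := isLeast_cubic_root_perm (p' := q) (q' := p) (r' := r) hw (by ring)
  have hw0 : 0 < w := hw.1.1
  have hqr1 := mul_mul_cubic_root_sq_lt_one_right hp hq hr hpqr hrq hw
  have hpr1 := mul_mul_cubic_root_sq_lt_one_left hp hq hr hpqr hrp hw
  obtain ⟨b, hb0, hbs, hbb, hbc, hbx, hby⟩ :=
    exists_isBalanced_axisSeries hp hq hr hpqr hrp hrq hw
  have hbs' : Summable fun n => (b n : ℂ) := (Complex.hasSum_ofReal.2 hbs.hasSum).summable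
  have hbb' := isBalanced_ofReal.2 hbb
  let π : ℕ × ℕ → ℝ := fun n => boundaryWeight p q r n * b n
  let Q : ℂ → ℂ → ℂ := fun x y => ∑' n : ℕ × ℕ, (b n : ℂ) * x ^ n.1 * y ^ n.2
  have hQ : ∀ x y : ℂ, ‖x‖ ≤ 1 → ‖y‖ ≤ 1 →
      HasSum (fun n : ℕ × ℕ => (b n : ℂ) * x ^ n.1 * y ^ n.2) (Q x y) := fun x y hx hy =>
    (summable_pow_mul_pow hbs' hx hy).hasSum
  have hQx : ∀ x : ℂ, ‖x‖ ≤ 1 → Q x 0 = axisSeries (originMass p q r w) p q r w x := fun x hx =>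
    (hQ x 0 hx (by simp)).pow_mul_pow_zero_right.unique (hbx x hx)
  have hQy : ∀ y : ℂ, ‖y‖ ≤ 1 → Q 0 y = axisSeries (originMass p q r w) q p r w y := fun y hy =>
    (hQ 0 y (by simp) hy).pow_mul_pow_zero_left.unique (hby y hy)
  have hQ0 : Q 0 0 = originMass p q r w := by
    rw [hQx 0 (by simp), axisSeries_zero hp.ne']
  have hπ0 : π (0, 0) = originMass p q r w := by
    simp only [π, boundaryWeight_zero_zero hr hpqr, one_mul, hbc]
  have hQsol : IsFlattoHahnSolution p q r Q := (isFlattoHahnSolution_iff hQ).2 hbb'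
  have hrow : HasSum (fun i => b (i, 0)) ((q - r) / (3 * q)) := by
    have h := hbx 1 (by simp)
    rw [axisSeries_one hp hq hr hpqr hrp hrq hw] at h
    simp only [one_pow, mul_one] at h
    exact Complex.hasSum_ofReal.1 h
  have hcol : HasSum (fun j => b (0, j)) ((p - r) / (3 * p)) := by
    have h := hby 1 (by simp)
    rw [← originMass_swap, axisSeries_one hq hp hr hqpr hrq hrp hws] at h
    simp only [one_pow, mul_one] at h
    exact Complex.hasSum_ofReal.1 h
  have hmass : HasSum b (1 / 3) := by
    have h := hbb'.hasSum_mul_sub hp.ne' hpqr (Complex.hasSum_ofReal.2 hbs.hasSum)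
      (Complex.hasSum_ofReal.2 hcol) (by rwa [abs_of_pos hr, abs_of_pos hp])
    have h' : (p - r) * ∑' n, b n = p * ((p - r) / (3 * p)) := by exact_mod_cast h
    have hne : p - r ≠ 0 := (sub_pos.2 hrp).ne'
    have : ∑' n, b n = 1 / 3 := by
      field_simp at h'
      linarith
    exact this ▸ hbs.hasSum
  have hπ : IsStationaryDistribution (quadrantTransition p q r p' r' q'' r'') π := by
    refine ⟨fun n => mul_nonneg (boundaryWeight_pos hp hq hr hpqr n).le (hb0 n), ?_, ?_⟩
    · have h := hasSum_boundaryWeight_mul (p := p) (q := q) (r := r) hmass hcol hrow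
      -- Total mass of `π`: the numerator is `(1 - p - q + 2r) / 3 = r`, which is why the balanced
      -- array has mass `1 / 3`.
      have e : (1 / 3 - p * ((p - r) / (3 * p)) - q * ((q - r) / (3 * q))) / r = 1 := by
        field_simp
        linarith
      rwa [e] at h
    · exact (stationary_iff_isBalanced hr hpqr hr' hpr' hr'' hqr'' hα hβ b).2 hbb
  have hre : ∀ {s : ℝ}, 0 < s → s * r * w ^ 2 < 1 → ∀ x : ℂ, ‖x‖ ≤ 1 →
      0 < (1 - x * s * r * w ^ 2).re := by
    intro s hs h x hx
    apply Complex.re_one_sub_pos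
    rw [norm_mul_mul_mul_sq hs.le hr.le]
    exact (mul_le_of_le_one_left (by positivity) hx).trans_lt h
  refine ⟨w, hw, π, hπ, fun π' hπ' =>
    hπ.unique hp hq hr hpqr hr' hpr' hr'' hqr'' hα hβ hπ', fun hne => ?_, fun heq => ?_, Q, hQsol,
    by rw [hQ0, hπ0], fun Q' hQ' h0 x y hx hy => ?_, fun x hx hqx => ?_, fun y hy hpy => ?_,
    fun heq => ⟨cubic_root_eq hp hq hr hpqr hw hrp heq, fun x hx => ?_⟩, fun x hx => ?_,
    fun y hy => ?_, fun x y hx hy => ?_⟩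
  · rw [hπ0, originMass_of_ne hp hq hr hpqr hrp hrq hw hne]
  · rw [hπ0, originMass_of_eq hp hq hr hpqr hrp hrq hw heq]
  · exact hQsol.eq_of_apply_zero_zero_eq hp hq hr.le hpqr hQ' (by rw [h0, hQ0, hπ0]) hx hy
  · rw [hQx x hx, hQ0]
    exact axisSeries_eq hp.ne' hw0.ne' hq.ne' (sub_nonneg.2 hpr1.le) (hre hq hqr1 x hx)
      (sub_mul_ne_zero (R := 1) hr (by rwa [one_mul]) hx) hqx
  · rw [hQy y hy, hQ0]
    exact axisSeries_eq hq.ne' hw0.ne' hp.ne' (sub_nonneg.2 hqr1.le) (hre hp hpr1 y hy)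
      (sub_mul_ne_zero (R := 1) hr (by rwa [one_mul]) hy) hpy
  · have hwe := cubic_root_eq hp hq hr hpqr hw hrp heq
    subst heq
    rw [hQx x hx, hQy x hx, hQ0, hwe]
    exact ⟨axisSeries_of_eq hr hrp hx, axisSeries_of_eq hr hrp hx⟩
  · have h := (hasSum_succ_mul_pow_succ (a := fun i => (b (i, 0) : ℂ)) (hbx x hx)
      (t := Q 0 0) (by rw [hbc, hQ0])).mul_left (1 / r' : ℂ)
    rw [hQx x hx]
    refine h.congr_fun fun i => ?_
    simp only [π, boundaryWeight_succ_zero hr hpqr hr' hpr' hα]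
    push_cast
    ring
  · have h := (hasSum_succ_mul_pow_succ (a := fun j => (b (0, j) : ℂ)) (hby y hy)
      (t := Q 0 0) (by rw [hbc, hQ0])).mul_left (1 / r'' : ℂ)
    rw [hQy y hy]
    refine h.congr_fun fun i => ?_
    simp only [π, boundaryWeight_zero_succ hr hpqr hr'' hqr'' hβ]
    push_cast
    ring
  · have h := (hasSum_succ_succ (hQ x y hx hy)
      (by simpa using (hQ x 0 hx (by simp)).pow_mul_pow_zero_right)
      (by simpa using (hQ 0 y (by simp) hy).pow_mul_pow_zero_left)
      (show _ = Q 0 0 by simp [hbc, hQ0])).mul_left (1 / r : ℂ)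
    refine h.congr_fun fun n => ?_
    simp only [π, boundaryWeight_succ_succ]
    push_cast
    ring
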